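/- Let $m,n,k$ be integers with $1\le k<\min\{m,n\}$ and write $\mathbb{R}^{a\times b}_k$ for the set of real $a\times b$ matrices of rank $k$. Let $\mathcal{Y}=\mathbb{R}^{m\times k}_k\times\mathbb{R}^{k\times n}_k$ with the Euclidean metric $\|(L,R)\|^2=\|L\|_F^2+\|R\|_F^2$, and let $G_{\mathcal{M}}:\mathcal{Y}\to\mathbb{R}^{m\times n}$, $G_{\mathcal{M}}(L,R)=LR$, where $\mathbb{R}^{m\times n}$ carries the Frobenius norm. For $y_0=(L,R)\in\mathcal{Y}$ and $x_0=LR$, the least-squares condition number $\kappa_{LS}^{inv}[G_{\mathcal{M}}](L,R)$ is defined as follows. Take a neighbourhood $\widehat{\mathcal{Y}}$ of $y_0$ in $\mathcal{Y}$ such that $\mathcal{X}=G_{\mathcal{M}}(\widehat{\mathcal{Y}})$ is an embedded submanifold of $\mathbb{R}^{m\times n}$, and let $H$ be the smooth least-squares solution map $$H(x)=\operatorname*{arg\,min}_{y\in\widehat{\mathcal{Y}},\ G_{\mathcal{M}}(y)=x} d_{\widehat{\mathcal{Y}}}(y_0,y),$$ defined for $x$ in a neighbourhood of $x_0$ in $\mathcal{X}$.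 Then $\kappa_{LS}^{inv}[G_{\mathcal{M}}](L,R)$ is the smallest number $\kappa\ge 0$ such that $d_{\widehat{\mathcal{Y}}}(H(x_0),H(x))\le\kappa\, d_{\mathcal{X}}(x_0,x)+o(d_{\mathcal{X}}(x_0,x))$ as $x\to x_0$ in $\mathcal{X}$. Here $d_{\mathcal{X}}$ and $d_{\widehat{\mathcal{Y}}}$ are the geodesic distances for the induced Euclidean metrics. Let $X\in\mathbb{R}^{m\times n}_k$ and let $\sigma_k(X)$ be its $k$th largest singular value. Then $\kappa_{LS}^{inv}[G_{\mathcal{M}}](L,R)$ is well defined (such $\widehat{\mathcal{Y}}$ and $H$ exist, and the value does not depend on their choice) for every $(L,R)\in\mathcal{Y}$ with $LR=X$, and $$\min_{(L,R)\in\mathcal{Y},\ LR=X}\kappa_{LS}^{inv}[G_{\mathcal{M}}](L,R)=\sigma_k(X)^{-1/2}.$$ If $X=U\Sigma V^T$ is a compact singular value decomposition ($U\in\mathbb{R}^{m\times k}$ and $V\in\mathbb{R}^{n\times k}$ with orthonormal columns, $\Sigma\in\mathbb{R}^{k\times k}$ diagonal with positive diagonal entries), then the minimum is attained at $(L,R)=(U\Sigma^{1/2},\Sigma^{1/2}V^T)$.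 -/

import Mathlib

open Set Filter Topology MeasureTheory
open scoped ENNReal ContDiff Matrix

/- Matrices carry the Euclidean (Frobenius) norm. -/
attribute [local instance] Matrix.frobeniusNormedAddCommGroup Matrix.frobeniusNormedSpace

noncomputable section

/-- `S` is a (smooth, embedded) submanifold of codimension `c` of the normed space `E`: locally it
is the zero set of a smooth submersion to `ℝᶜ`. -/
def IsEmbeddedSubmanifold {E : Type*} [NormedAddCommGroup E] [NormedSpace ℝ E]
    (c : ℕ) (S : Set E) : Prop :=
  ∀ p ∈ S, ∃ (V : Set E) (Φ : E → EuclideanSpace ℝ (Fin c)),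
    IsOpen V ∧ p ∈ V ∧ ContDiffOn ℝ ∞ Φ V ∧
    (∀ q ∈ V, Function.Surjective (fderiv ℝ Φ q)) ∧
    S ∩ V = {q ∈ V | Φ q = 0}

/-- The geodesic distance in a submanifold `S` of `E` with the induced metric: the infimum of the
lengths of the `C¹` curves in `S` from `x` to `y` (`∞` if there is no such curve). -/
def geodesicEDist {E : Type*} [NormedAddCommGroup E] [NormedSpace ℝ E]
    (S : Set E) (x y : E) : ℝ≥0∞ :=
  ⨅ (γ : ℝ → E) (_ : ContDiffOn ℝ 1 γ (Icc 0 1)) (_ : MapsTo γ (Icc 0 1) S)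
    (_ : γ 0 = x) (_ : γ 1 = y),
    ∫⁻ t in Icc (0 : ℝ) 1, ‖derivWithin γ (Icc 0 1) t‖ₑ

/-- `κ` is an error bound for `H` at `x₀`:
`d (H x₀) (H x) ≤ κ * d x₀ x + o (d x₀ x)` as `x → x₀` in `U`, for the geodesic distances in
`X ⊇ U` and in `Y`. -/
def IsFirstOrderErrorBound {E F : Type*} [NormedAddCommGroup E] [NormedSpace ℝ E]
    [NormedAddCommGroup F] [NormedSpace ℝ F]
    (X U : Set E) (Y : Set F) (H : E → F) (x₀ : E) (κ : ℝ) : Prop :=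
  ∀ ε > 0, ∀ᶠ x in 𝓝[U] x₀,
    geodesicEDist Y (H x₀) (H x) ≤ ENNReal.ofReal (κ + ε) * geodesicEDist X x₀ x

/-- `κ` is the condition number of `H : U → Y` at `x₀`: the smallest nonnegative number that is a
first-order error bound. -/
def IsConditionNumber {E F : Type*} [NormedAddCommGroup E] [NormedSpace ℝ E]
    [NormedAddCommGroup F] [NormedSpace ℝ F]
    (X U : Set E) (Y : Set F) (H : E → F) (x₀ : E) (κ : ℝ) : Prop :=
  IsLeast {κ' : ℝ | 0 ≤ κ' ∧ IsFirstOrderErrorBound X U Y H x₀ κ'} κ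

/-- `y` is the unique minimiser, over the solutions `y' ∈ Y` of `F x y' = c`, of the geodesic
distance in `Y` to `y₀`. -/
def IsClosestSolution {E₁ E₂ E₃ : Type*} [NormedAddCommGroup E₂] [NormedSpace ℝ E₂]
    (F : E₁ → E₂ → E₃) (c : E₃) (Y : Set E₂) (y₀ : E₂) (x : E₁) (y : E₂) : Prop :=
  y ∈ Y ∧ F x y = c ∧
    ∀ y' ∈ Y, F x y' = c → y' ≠ y → geodesicEDist Y y₀ y < geodesicEDist Y y₀ y'

/-- `H` is a least-squares solution map of `F x y = c` on `U ⊆ X` for the reference solution `y₀`: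
a smooth map sending every `x ∈ U` to the solution that is closest to `y₀`. -/
def IsLeastSquaresSolutionMap {E₁ E₂ E₃ : Type*} [NormedAddCommGroup E₁] [NormedSpace ℝ E₁]
    [NormedAddCommGroup E₂] [NormedSpace ℝ E₂]
    (F : E₁ → E₂ → E₃) (c : E₃) (U : Set E₁) (Y : Set E₂) (y₀ : E₂) (H : E₁ → E₂) : Prop :=
  ContDiffOn ℝ ∞ H U ∧ ∀ x ∈ U, IsClosestSolution F c Y y₀ x (H x)

/-- `κ` is the least-squares condition number of the equation `F x y = c`, with inputs `x ∈ X` and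
outputs `y ∈ Y`, at the solution `(x₀, y₀)`: the condition number at `x₀` of the least-squares
solution map, which is defined on a neighbourhood `U` of `x₀` in `X`. -/
def IsLeastSquaresConditionNumber {E₁ E₂ E₃ : Type*}
    [NormedAddCommGroup E₁] [NormedSpace ℝ E₁] [NormedAddCommGroup E₂] [NormedSpace ℝ E₂]
    (F : E₁ → E₂ → E₃) (c : E₃) (X : Set E₁) (Y : Set E₂) (x₀ : E₁) (y₀ : E₂) (κ : ℝ) : Prop :=
  x₀ ∈ X ∧ y₀ ∈ Y ∧ F x₀ y₀ = c ∧
    ∃ (U : Set E₁) (H : E₁ → E₂), U ⊆ X ∧ U ∈ 𝓝[X] x₀ ∧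
      IsLeastSquaresSolutionMap F c U Y y₀ H ∧ IsConditionNumber X U Y H x₀ κ

/-- `κ` is the least-squares condition number at `y₀ ∈ Y` of the inverse problem `G y - x = 0`:
for some neighbourhood `Y ∩ V` of `y₀` in `Y` whose image `X = G (Y ∩ V)` is an embedded
submanifold, it is the least-squares condition number at `(G y₀, y₀)` of this equation with inputs
`x ∈ X` and outputs `y ∈ Y ∩ V`. -/
def IsInverseLSConditionNumber {E₁ E₂ : Type*}
    [NormedAddCommGroup E₁] [NormedSpace ℝ E₁] [NormedAddCommGroup E₂] [NormedSpace ℝ E₂]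
    (G : E₂ → E₁) (Y : Set E₂) (y₀ : E₂) (κ : ℝ) : Prop :=
  ∃ V : Set E₂, IsOpen V ∧ y₀ ∈ Y ∩ V ∧
    (∃ c, IsEmbeddedSubmanifold c (G '' (Y ∩ V))) ∧
    IsLeastSquaresConditionNumber (fun x y ↦ G y - x) 0 (G '' (Y ∩ V)) (Y ∩ V) (G y₀) y₀ κ

/-- Pairs `(L, R)` of an `m × k` and a `k × n` matrix, with the Euclidean norm
`√(‖L‖² + ‖R‖²)`. -/
abbrev FactorPair (m n k : ℕ) : Type :=
  WithLp 2 (Matrix (Fin m) (Fin k) ℝ × Matrix (Fin k) (Fin n) ℝ)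

/-- The domain of the two-factor decomposition problem: both factors have rank `k`. -/
def fullRankPairs (m n k : ℕ) : Set (FactorPair m n k) :=
  {y | y.fst.rank = k ∧ y.snd.rank = k}

/-- The map `(L, R) ↦ L R`. -/
def factorProduct (m n k : ℕ) (y : FactorPair m n k) : Matrix (Fin m) (Fin n) ℝ :=
  y.fst * y.snd

/-- `κ` is the least-squares condition number of the two-factor matrix decomposition problem at
`(L, R)`. -/
def IsTwoFactorConditionNumber {m n k : ℕ} (L : Matrix (Fin m) (Fin k) ℝ)
    (R : Matrix (Fin k) (Fin n) ℝ) (κ : ℝ) : Prop :=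
  IsInverseLSConditionNumber (factorProduct m n k) (fullRankPairs m n k) (WithLp.toLp 2 (L, R)) κ

/-- The `i`-th largest singular value of a real matrix, counted from `i = 1`. -/
def sigma {m n : ℕ} (i : ℕ) (A : Matrix (Fin m) (Fin n) ℝ) : ℝ :=
  (Matrix.toEuclideanLin A).singularValues (i - 1)

/-- `A = U Σ Vᵀ` with `Σ = diag s` is a compact singular value decomposition: `U` and `V` have
orthonormal columns and the entries of `s` are positive (no ordering of them is required). -/
def IsCompactSVD {m n k : ℕ} (A : Matrix (Fin m) (Fin n) ℝ) (U : Matrix (Fin m) (Fin k) ℝ)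
    (s : Fin k → ℝ) (V : Matrix (Fin n) (Fin k) ℝ) : Prop :=
  Uᵀ * U = 1 ∧ Vᵀ * V = 1 ∧ (∀ i, 0 < s i) ∧ A = U * Matrix.diagonal s * Vᵀ

end

/-! ### Geodesic distances -/

section Geodesic

variable {E : Type*} [NormedAddCommGroup E] [NormedSpace ℝ E]

/-! The fibre of the product through `(L, R)` is an orbit of `(L, R) ↦ (L A, A⁻¹ R)`, with tangent
vectors `(L B, -B R)`. Hence `y - y₀` is orthogonal to the fibre at `y` exactly when `fiberResidual
y₀ y = 0`. The implicit function theorem in the variable `A` yields an analytic solution map with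
zero residual, and near `y₀` a zero residual forces strict minimality in the fibre. Every
least-squares solution map therefore has the same germ, and since geodesic and Euclidean distances
agree to first order, the condition number is a Euclidean quantity independent of all choices
(`isInverseLSConditionNumber_factorProduct_iff`).

To first order a displacement `(a, b)` of the solution satisfies `Lᵀ a = b Rᵀ` and changes the
product by `L b + a R`. The two summands have inner product `‖Lᵀ a‖² ≥ 0`, so the change is at least
`min (σ_k L) (σ_k R)` times `‖(a, b)‖` (`isEuclideanErrorBound_inv`). Conversely, as `k < m` and `k
< n`, perturbing one factor in a direction orthogonal to the column space of `L`, or to the row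
space of `R`, shows that any error bound `κ` satisfies `κ σ_k(R) ≥ 1` and `κ σ_k(L) ≥ 1`. Since
`σ_k(L R) ≥ σ_k(L) σ_k(R)`, this would only bound `σ_k(X)` from below by `κ⁻²`, which is what is
needed: `κ² σ_k(X) ≥ 1` (`inv_sqrt_sigma_le_of_isEuclideanErrorBound`). The balanced factors have
`σ_k(L) = σ_k(R) = √σ_k(X)` and give equality. -/

theorem enorm_sub_le_geodesicEDist (S : Set E) (x y : E) : ‖y - x‖ₑ ≤ geodesicEDist S x y := by
  simp only [geodesicEDist, le_iInf_iff]
  rintro γ hγ - rfl rfl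
  exact enorm_sub_le_lintegral_derivWithin_Icc_of_contDiffOn_Icc hγ zero_le_one

theorem geodesicEDist_le_of_hasDerivAt {S : Set E} {x y : E} {C : ℝ} (γ γ' : ℝ → E)
    (hγ : ∀ t, HasDerivAt γ (γ' t) t) (hc : Continuous γ') (hS : MapsTo γ (Icc 0 1) S)
    (h0 : γ 0 = x) (h1 : γ 1 = y) (hC : ∀ t ∈ Icc (0 : ℝ) 1, ‖γ' t‖ ≤ C) :
    geodesicEDist S x y ≤ ENNReal.ofReal C := by
  have hcd : ContDiff ℝ 1 γ := by
    rw [contDiff_one_iff_deriv]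
    refine ⟨fun t ↦ (hγ t).differentiableAt, ?_⟩
    rwa [show deriv γ = γ' from funext fun t ↦ (hγ t).deriv]
  refine (iInf₂_le_of_le γ hcd.contDiffOn (iInf₂_le_of_le hS h0 (iInf_le_of_le h1 le_rfl))).trans ?_
  calc ∫⁻ t in Icc (0 : ℝ) 1, ‖derivWithin γ (Icc 0 1) t‖ₑ
      ≤ ∫⁻ _ in Icc (0 : ℝ) 1, ENNReal.ofReal C := by
        refine setLIntegral_mono measurable_const fun t ht ↦ ?_
        rw [(hγ t).hasDerivWithinAt.derivWithin (uniqueDiffOn_Icc_zero_one t ht),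
          ← ofReal_norm]
        exact ENNReal.ofReal_le_ofReal (hC t ht)
    _ = ENNReal.ofReal C := by simp

theorem geodesicEDist_eq_of_segment {S : Set E} {x y : E} (h : segment ℝ x y ⊆ S) :
    geodesicEDist S x y = ‖y - x‖ₑ := by
  refine le_antisymm ?_ (enorm_sub_le_geodesicEDist S x y)
  rw [← ofReal_norm]
  refine geodesicEDist_le_of_hasDerivAt (fun t ↦ x + t • (y - x)) (fun _ ↦ y - x) (fun t ↦ ?_)
    continuous_const (fun t ht ↦ h ?_) (by simp) (by simp) fun _ _ ↦ le_rfl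
  · simpa using ((hasDerivAt_id t).smul_const (y - x)).const_add x
  · rw [segment_eq_image']
    exact ⟨t, ht, rfl⟩

end Geodesic

/-! ### Matrices with the Frobenius norm -/

namespace Matrix

variable {l m n : Type*} [Fintype l] [Fintype m] [Fintype n]

theorem frobenius_norm_sq (A : Matrix m n ℝ) : ‖A‖ ^ 2 = ∑ i, ∑ j, A i j ^ 2 := by
  rw [frobenius_norm_def, ← Real.sqrt_eq_rpow, Real.sq_sqrt]
  · simp
  · positivity

theorem frobenius_norm_sq_eq_trace (A : Matrix m n ℝ) : ‖A‖ ^ 2 = (Aᵀ * A).trace := by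
  rw [frobenius_norm_sq, Finset.sum_comm]
  simp [trace, mul_apply, sq]

theorem abs_trace_transpose_mul_le (A B : Matrix m n ℝ) : |(Aᵀ * B).trace| ≤ ‖A‖ * ‖B‖ := by
  have h : (Aᵀ * B).trace = ∑ q : m × n, A q.1 q.2 * B q.1 q.2 := by
    rw [Fintype.sum_prod_type, Finset.sum_comm]
    simp [trace, mul_apply]
  refine abs_le_of_sq_le_sq ?_ (by positivity)
  rw [h, mul_pow, frobenius_norm_sq, frobenius_norm_sq, ← Fintype.sum_prod_type',
    ← Fintype.sum_prod_type']
  exact Finset.sum_mul_sq_le_sq_mul_sq _ _ _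

theorem frobenius_norm_add_sq (A B : Matrix m n ℝ) :
    ‖A + B‖ ^ 2 = ‖A‖ ^ 2 + 2 * (Aᵀ * B).trace + ‖B‖ ^ 2 := by
  have h : (Bᵀ * A).trace = (Aᵀ * B).trace := by rw [← trace_transpose]; simp
  simp only [frobenius_norm_sq_eq_trace, transpose_add, Matrix.add_mul, Matrix.mul_add, trace_add,
    h]
  ring

/-- Matrix multiplication as a continuous bilinear map. -/
noncomputable def mulCLM (l m n : Type*) [Fintype l] [Fintype m] [Fintype n] :
    Matrix l m ℝ →L[ℝ] Matrix m n ℝ →L[ℝ] Matrix l n ℝ :=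
  LinearMap.mkContinuous₂ (LinearMap.mk₂ ℝ (fun A B ↦ A * B) Matrix.add_mul
    (fun c A B ↦ Matrix.smul_mul c A B) Matrix.mul_add (fun c A B ↦ Matrix.mul_smul A c B)) 1
    fun A B ↦ by simpa using frobenius_norm_mul A B

/-- Transposition as a continuous linear map. -/
noncomputable def transposeCLM (m n : Type*) [Fintype m] [Fintype n] :
    Matrix m n ℝ →L[ℝ] Matrix n m ℝ :=
  LinearMap.mkContinuous (transposeLinearEquiv m n ℝ ℝ).toLinearMap 1
    fun A ↦ by simp

end Matrix

/-! ### Smoothness of matrix multiplication, transposition and inversion. -/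

section ContDiff

variable {l m n : Type*} [Fintype l] [Fintype m] [Fintype n]
variable {E : Type*} [NormedAddCommGroup E] [NormedSpace ℝ E] {N : ℕ∞ω} {x : E}

theorem Matrix.isBoundedBilinearMap_mul :
    IsBoundedBilinearMap ℝ fun p : Matrix l m ℝ × Matrix m n ℝ ↦ p.1 * p.2 :=
  (Matrix.mulCLM l m n).isBoundedBilinearMap

theorem ContDiffAt.matrix_mul {f : E → Matrix l m ℝ} {g : E → Matrix m n ℝ}
    (hf : ContDiffAt ℝ N f x) (hg : ContDiffAt ℝ N g x) :
    ContDiffAt ℝ N (fun x ↦ f x * g x) x :=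
  Matrix.isBoundedBilinearMap_mul.contDiff.contDiffAt.comp x (hf.prodMk hg)

theorem ContDiffAt.matrix_transpose {f : E → Matrix l m ℝ} (hf : ContDiffAt ℝ N f x) :
    ContDiffAt ℝ N (fun x ↦ (f x)ᵀ) x :=
  (Matrix.transposeCLM l m).contDiff.contDiffAt.comp x hf

theorem HasDerivAt.matrix_mul {f : ℝ → Matrix l m ℝ} {g : ℝ → Matrix m n ℝ} {f' : Matrix l m ℝ}
    {g' : Matrix m n ℝ} {t : ℝ} (hf : HasDerivAt f f' t) (hg : HasDerivAt g g' t) :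
    HasDerivAt (fun t ↦ f t * g t) (f t * g' + f' * g t) t := by
  have h := (Matrix.isBoundedBilinearMap_mul (l := l) (m := m) (n := n)).hasFDerivAt (f t, g t)
  exact h.comp_hasDerivAt t (hf.prodMk hg)

theorem ContDiffAt.matrix_inv [DecidableEq m] {f : E → Matrix m m ℝ} (hf : ContDiffAt ℝ N f x)
    (hx : IsUnit (f x).det) : ContDiffAt ℝ N (fun x ↦ (f x)⁻¹) x := by
  let _ : NormedRing (Matrix m m ℝ) := Matrix.frobeniusNormedRing
  let _ : NormedAlgebra ℝ (Matrix m m ℝ) := Matrix.frobeniusNormedAlgebra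
  obtain ⟨u, hu⟩ := (Matrix.isUnit_iff_isUnit_det _).2 hx
  have h : ContDiffAt ℝ N (Ring.inverse : Matrix m m ℝ → Matrix m m ℝ) (f x) := by
    rw [← hu]
    exact contDiffAt_ringInverse ℝ u
  have h2 := h.comp x hf
  simp only [Matrix.nonsing_inv_eq_ringInverse]
  exact h2

end ContDiff

/-! ### Factor pairs and local sections of the product -/

section Rank

variable {m n k : ℕ}

/-- With `P` fixed, invertibility of `P * L` is an open condition on `L`; this is how full rank is
propagated to nearby matrices. -/
theorem Matrix.rank_eq_of_isUnit_det_mul {P : Matrix (Fin k) (Fin m) ℝ}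
    {L : Matrix (Fin m) (Fin k) ℝ} (h : IsUnit (P * L).det) : L.rank = k := by
  refine le_antisymm L.rank_le_width ?_
  calc k = (P * L).rank := by
        rw [Matrix.rank_of_isUnit _ ((Matrix.isUnit_iff_isUnit_det _).2 h), Fintype.card_fin]
    _ ≤ L.rank := Matrix.rank_mul_le_right _ _

theorem Matrix.rank_eq_of_isUnit_det_mul' {R : Matrix (Fin k) (Fin n) ℝ}
    {Q : Matrix (Fin n) (Fin k) ℝ} (h : IsUnit (R * Q).det) : R.rank = k := by
  rw [← Matrix.rank_transpose]
  refine Matrix.rank_eq_of_isUnit_det_mul (P := Qᵀ) ?_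
  rwa [← Matrix.transpose_mul, Matrix.det_transpose]

theorem Matrix.exists_left_inverse_of_rank_eq {L : Matrix (Fin m) (Fin k) ℝ} (h : L.rank = k) :
    ∃ P : Matrix (Fin k) (Fin m) ℝ, P * L = 1 := by
  refine ⟨(Lᵀ * L)⁻¹ * Lᵀ, ?_⟩
  rw [Matrix.mul_assoc, Matrix.nonsing_inv_mul]
  rw [← Matrix.isUnit_iff_isUnit_det, ← Matrix.mulVec_surjective_iff_isUnit,
    ← Matrix.coe_mulVecLin, ← LinearMap.range_eq_top]
  apply Submodule.eq_top_of_finrank_eq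
  have := Matrix.rank_transpose_mul_self L
  rw [Matrix.rank] at this
  simp [this, h]

theorem Matrix.exists_right_inverse_of_rank_eq {R : Matrix (Fin k) (Fin n) ℝ} (h : R.rank = k) :
    ∃ Q : Matrix (Fin n) (Fin k) ℝ, R * Q = 1 := by
  rw [← Matrix.rank_transpose] at h
  obtain ⟨P, hP⟩ := Matrix.exists_left_inverse_of_rank_eq h
  exact ⟨Pᵀ, by rw [← Matrix.transpose_transpose R, ← Matrix.transpose_mul, hP,
    Matrix.transpose_one]⟩

/-- The space splits as the range of `L` plus the kernel of `P`. The columns of `L₁` are a basis of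
that kernel, and `P₁` takes coordinates of the projection `1 - L P` onto it. -/
theorem Matrix.exists_complement_of_mul_eq_one {P : Matrix (Fin k) (Fin m) ℝ}
    {L : Matrix (Fin m) (Fin k) ℝ} (h : P * L = 1) :
    ∃ (L₁ : Matrix (Fin m) (Fin (m - k)) ℝ) (P₁ : Matrix (Fin (m - k)) (Fin m) ℝ),
      P * L₁ = 0 ∧ P₁ * L₁ = 1 ∧ L * P + L₁ * P₁ = 1 := by
  have hrank : Module.finrank ℝ (LinearMap.ker P.mulVecLin) = m - k := by
    have h1 := LinearMap.finrank_range_add_finrank_ker P.mulVecLin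
    have h2 : P.rank = k := Matrix.rank_eq_of_isUnit_det_mul' (Q := L) (by simp [h])
    rw [Matrix.rank] at h2
    rw [h2, Module.finrank_fin_fun] at h1
    omega
  let b := Module.finBasisOfFinrankEq ℝ _ hrank
  let f : (Fin (m - k) → ℝ) →ₗ[ℝ] (Fin m → ℝ) :=
    (LinearMap.ker P.mulVecLin).subtype ∘ₗ b.equivFun.symm.toLinearMap
  let q : (Fin m → ℝ) →ₗ[ℝ] LinearMap.ker P.mulVecLin :=
    LinearMap.codRestrict _ (LinearMap.id - (L * P).mulVecLin) fun v ↦ by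
      simp [Matrix.mulVec_sub, ← Matrix.mul_assoc, h]
  let g : (Fin m → ℝ) →ₗ[ℝ] (Fin (m - k) → ℝ) := b.equivFun.toLinearMap ∘ₗ q
  have hPf : P.mulVecLin ∘ₗ f = 0 := LinearMap.ext fun v ↦ (b.equivFun.symm v).2
  have hgf : g ∘ₗ f = LinearMap.id := by
    refine LinearMap.ext fun v ↦ b.equivFun.symm.injective ?_
    have hv : P *ᵥ f v = 0 := (b.equivFun.symm v).2
    have hq : q (f v) = b.equivFun.symm v := by
      refine Subtype.ext ?_
      change f v - (L * P) *ᵥ f v = f v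
      rw [← Matrix.mulVec_mulVec, hv, Matrix.mulVec_zero, sub_zero]
    change b.equivFun.symm (b.equivFun (q (f v))) = _
    rw [LinearEquiv.symm_apply_apply, hq]
    rfl
  have hfg : f ∘ₗ g = LinearMap.id - (L * P).mulVecLin := by
    refine LinearMap.ext fun v ↦ ?_
    simp [f, g, q]
  refine ⟨LinearMap.toMatrix' f, LinearMap.toMatrix' g, ?_, ?_, ?_⟩
  · have := congrArg LinearMap.toMatrix' hPf
    rwa [LinearMap.toMatrix'_comp, ← Matrix.toLin'_apply', LinearMap.toMatrix'_toLin',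
      map_zero] at this
  · rw [← LinearMap.toMatrix'_comp, hgf, LinearMap.toMatrix'_id]
  · rw [← LinearMap.toMatrix'_comp, hfg, map_sub, LinearMap.toMatrix'_id,
      ← Matrix.toLin'_apply', LinearMap.toMatrix'_toLin', add_sub_cancel]

end Rank

/-! ### Smooth local sections of the product map and its images as embedded submanifolds. -/

section FactorPair

variable {m n k : ℕ}
variable {E : Type*} [NormedAddCommGroup E] [NormedSpace ℝ E] {N : ℕ∞ω} {x : E}

theorem ContDiffAt.toLp_prodMk {f : E → Matrix (Fin m) (Fin k) ℝ}
    {g : E → Matrix (Fin k) (Fin n) ℝ} (hf : ContDiffAt ℝ N f x) (hg : ContDiffAt ℝ N g x) :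
    ContDiffAt ℝ N (fun x ↦ (WithLp.toLp 2 (f x, g x) : FactorPair m n k)) x := by
  have h : ContDiff ℝ N (WithLp.prodContinuousLinearEquiv 2 ℝ (Matrix (Fin m) (Fin k) ℝ)
    (Matrix (Fin k) (Fin n) ℝ)).symm := ContinuousLinearEquiv.contDiff _
  exact h.contDiffAt.comp x (hf.prodMk hg)

theorem FactorPair.contDiff_fst :
    ContDiff ℝ N (fun y : FactorPair m n k ↦ y.fst) :=
  (WithLp.fstL 2 ℝ (Matrix (Fin m) (Fin k) ℝ) (Matrix (Fin k) (Fin n) ℝ)).contDiff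

theorem FactorPair.contDiff_snd :
    ContDiff ℝ N (fun y : FactorPair m n k ↦ y.snd) :=
  (WithLp.sndL 2 ℝ (Matrix (Fin m) (Fin k) ℝ) (Matrix (Fin k) (Fin n) ℝ)).contDiff

theorem contDiff_factorProduct : ContDiff ℝ N (factorProduct m n k) :=
  contDiff_iff_contDiffAt.2 fun _ ↦
    FactorPair.contDiff_fst.contDiffAt.matrix_mul FactorPair.contDiff_snd.contDiffAt

theorem isOpen_setOf_isUnit_det {ι X : Type*} [Fintype ι] [DecidableEq ι] [TopologicalSpace X]
    {f : X → Matrix ι ι ℝ} (hf : Continuous f) : IsOpen {x | IsUnit (f x).det} := by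
  simp only [isUnit_iff_ne_zero]
  exact isOpen_ne_fun hf.matrix_det continuous_const

theorem isOpen_fullRankPairs : IsOpen (fullRankPairs m n k) := by
  rw [isOpen_iff_mem_nhds]
  rintro y ⟨h1, h2⟩
  obtain ⟨P, hP⟩ := Matrix.exists_left_inverse_of_rank_eq h1
  obtain ⟨Q, hQ⟩ := Matrix.exists_right_inverse_of_rank_eq h2
  have c1 : Continuous fun y : FactorPair m n k ↦ P * y.fst :=
    continuous_const.matrix_mul (FactorPair.contDiff_fst (N := 0)).continuous
  have c2 : Continuous fun y : FactorPair m n k ↦ y.snd * Q :=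
    (FactorPair.contDiff_snd (N := 0)).continuous.matrix_mul continuous_const
  filter_upwards [(isOpen_setOf_isUnit_det c1).mem_nhds (by simp [hP]),
    (isOpen_setOf_isUnit_det c2).mem_nhds (by simp [hQ])] with z hz1 hz2
  exact ⟨Matrix.rank_eq_of_isUnit_det_mul hz1, Matrix.rank_eq_of_isUnit_det_mul' hz2⟩

/-- Given `P` and `Q` with `P L = 1` and `R Q = 1`, a local section of `(L, R) ↦ L R` on the
matrices of rank `k`, defined wherever `P x Q` is invertible. -/
noncomputable def factorSection (P : Matrix (Fin k) (Fin m) ℝ) (Q : Matrix (Fin n) (Fin k) ℝ)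
    (x : Matrix (Fin m) (Fin n) ℝ) : FactorPair m n k :=
  WithLp.toLp 2 (x * Q * (P * x * Q)⁻¹, P * x)

variable {P : Matrix (Fin k) (Fin m) ℝ} {Q : Matrix (Fin n) (Fin k) ℝ}

theorem factorSection_factorProduct {y : FactorPair m n k} (hP : P * y.fst = 1)
    (hQ : y.snd * Q = 1) : factorSection P Q (factorProduct m n k y) = y := by
  have h1 : y.fst * y.snd * Q = y.fst := by rw [Matrix.mul_assoc, hQ, Matrix.mul_one]
  have h2 : P * (y.fst * y.snd) = y.snd := by rw [← Matrix.mul_assoc, hP, Matrix.one_mul]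
  rw [factorSection, factorProduct, h1, h2, hQ, inv_one, Matrix.mul_one]
  rfl

theorem isUnit_det_factorProduct {y : FactorPair m n k} (hP : P * y.fst = 1)
    (hQ : y.snd * Q = 1) : IsUnit (P * factorProduct m n k y * Q).det := by
  rw [factorProduct, ← Matrix.mul_assoc, hP, Matrix.one_mul, hQ]
  simp

/-- For `x = L R` one has `P x Q = (P L)(R Q)`. Both square factors are invertible because their
product is, so the inverse splits and cancels. Full rank of `y` is not assumed, which is why the
filters below can live on the whole range of the product. -/
theorem factorProduct_factorSection {y : FactorPair m n k}
    (h : IsUnit (P * factorProduct m n k y * Q).det) :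
    factorProduct m n k (factorSection P Q (factorProduct m n k y)) = factorProduct m n k y := by
  have e : P * factorProduct m n k y * Q = (P * y.fst) * (y.snd * Q) := by
    simp only [factorProduct, Matrix.mul_assoc]
  rw [e, Matrix.det_mul, IsUnit.mul_iff] at h
  simp only [factorSection, e]
  simp only [factorProduct]
  calc y.fst * y.snd * Q * ((P * y.fst) * (y.snd * Q))⁻¹ * (P * (y.fst * y.snd))
      = y.fst * ((y.snd * Q) * (y.snd * Q)⁻¹) * ((P * y.fst)⁻¹ * (P * y.fst)) * y.snd := by
        rw [Matrix.mul_inv_rev]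
        simp only [Matrix.mul_assoc]
    _ = y.fst * y.snd := by
        rw [Matrix.mul_nonsing_inv _ h.2, Matrix.nonsing_inv_mul _ h.1]
        simp

theorem contDiffAt_factorSection {x : Matrix (Fin m) (Fin n) ℝ} (h : IsUnit (P * x * Q).det) :
    ContDiffAt ℝ N (factorSection P Q) x := by
  have h1 : ContDiffAt ℝ N (fun x ↦ P * x) x := contDiffAt_const.matrix_mul contDiffAt_id
  have h2 : ContDiffAt ℝ N (fun x : Matrix (Fin m) (Fin n) ℝ ↦ x * Q) x :=
    contDiffAt_id.matrix_mul contDiffAt_const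
  exact (h2.matrix_mul ((h1.matrix_mul contDiffAt_const).matrix_inv h)).toLp_prodMk h1

theorem isOpen_setOf_isUnit_det_mul_mul (P : Matrix (Fin k) (Fin m) ℝ)
    (Q : Matrix (Fin n) (Fin k) ℝ) : IsOpen {x : Matrix (Fin m) (Fin n) ℝ | IsUnit (P * x * Q).det} :=
  isOpen_setOf_isUnit_det
    ((continuous_const.matrix_mul continuous_id).matrix_mul continuous_const)

/-- The product has local sections within the set of products of factor pairs. -/
theorem eventually_factorProduct_factorSection {y : FactorPair m n k} (hP : P * y.fst = 1)
    (hQ : y.snd * Q = 1) :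
    ∀ᶠ x in 𝓝[range (factorProduct m n k)] (factorProduct m n k y),
      factorProduct m n k (factorSection P Q x) = x := by
  filter_upwards [self_mem_nhdsWithin, mem_nhdsWithin_of_mem_nhds
    ((isOpen_setOf_isUnit_det_mul_mul P Q).mem_nhds (isUnit_det_factorProduct hP hQ))]
  rintro _ ⟨z, rfl⟩ hz
  exact factorProduct_factorSection hz

theorem tendsto_factorSection {y : FactorPair m n k} (hP : P * y.fst = 1) (hQ : y.snd * Q = 1) :
    Tendsto (factorSection P Q) (𝓝 (factorProduct m n k y)) (𝓝 y) := by
  have h := (contDiffAt_factorSection (N := 0) (isUnit_det_factorProduct hP hQ)).continuousAt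
  rwa [ContinuousAt, factorSection_factorProduct hP hQ] at h

theorem image_factorProduct_mem_nhdsWithin {y : FactorPair m n k} (hy : y ∈ fullRankPairs m n k)
    {W : Set (FactorPair m n k)} (hW : W ∈ 𝓝 y) :
    factorProduct m n k '' W ∈ 𝓝[range (factorProduct m n k)] (factorProduct m n k y) := by
  obtain ⟨P, hP⟩ := Matrix.exists_left_inverse_of_rank_eq hy.1
  obtain ⟨Q, hQ⟩ := Matrix.exists_right_inverse_of_rank_eq hy.2
  filter_upwards [eventually_factorProduct_factorSection hP hQ,
    (tendsto_factorSection hP hQ).mono_left nhdsWithin_le_nhds hW] with x h1 h2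
  exact ⟨_, h2, h1⟩

/-- The image of an open set of factor pairs of full rank is an embedded submanifold. -/
theorem isEmbeddedSubmanifold_image_factorProduct {W : Set (FactorPair m n k)} (hW : IsOpen W)
    (hWY : W ⊆ fullRankPairs m n k) :
    ∃ c, IsEmbeddedSubmanifold c (factorProduct m n k '' W) := by
  refine ⟨(m - k) * (n - k), ?_⟩
  rintro _ ⟨y, hyW, rfl⟩
  obtain ⟨P, hP⟩ := Matrix.exists_left_inverse_of_rank_eq (hWY hyW).1
  obtain ⟨Q, hQ⟩ := Matrix.exists_right_inverse_of_rank_eq (hWY hyW).2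
  obtain ⟨L₁, P₁, hPL₁, hPL₁', hLP⟩ := Matrix.exists_complement_of_mul_eq_one hP
  obtain ⟨R₁, Q₁, hQR₁, hQR₁', hRQ⟩ := Matrix.exists_complement_of_mul_eq_one
    (P := Qᵀ) (L := y.sndᵀ) (by rw [← Matrix.transpose_mul, hQ, Matrix.transpose_one])
  let φ : Matrix (Fin (m - k)) (Fin (n - k)) ℝ ≃L[ℝ]
      EuclideanSpace ℝ (Fin ((m - k) * (n - k))) :=
    ContinuousLinearEquiv.ofFinrankEq (by simp [Module.finrank_matrix])
  let D : Set (Matrix (Fin m) (Fin n) ℝ) := {q | IsUnit (P * q * Q).det}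
  have hD : IsOpen D := isOpen_setOf_isUnit_det_mul_mul P Q
  let V : Set (Matrix (Fin m) (Fin n) ℝ) := D ∩ factorSection P Q ⁻¹' W
  have hV : IsOpen V := by
    refine ContinuousOn.isOpen_inter_preimage (fun q hq ↦ ?_) hD hW
    exact (contDiffAt_factorSection (N := 0) hq).continuousAt.continuousWithinAt
  -- The defect of `q` from the product of its section is annihilated by `P` on the left and `Q` on
  -- the right. Only its `(m - k) × (n - k)` block remains, and that block is the defining equation.
  let Φ : Matrix (Fin m) (Fin n) ℝ → EuclideanSpace ℝ (Fin ((m - k) * (n - k))) :=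
    fun q ↦ φ (P₁ * (q - factorProduct m n k (factorSection P Q q)) * Q₁ᵀ)
  have hΦ : ∀ q ∈ V, ContDiffAt ℝ ∞ Φ q := fun q hq ↦ by
    have h1 := (contDiff_factorProduct (N := ∞)).contDiffAt.comp q
      (contDiffAt_factorSection (N := ∞) hq.1)
    exact φ.contDiff.contDiffAt.comp q
      ((contDiffAt_const.matrix_mul (contDiffAt_id.sub h1)).matrix_mul contDiffAt_const)
  refine ⟨V, Φ, hV, ⟨isUnit_det_factorProduct hP hQ, ?_⟩,
    fun q hq ↦ (hΦ q hq).contDiffWithinAt, fun q hq z ↦ ?_, ?_⟩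
  · rwa [mem_preimage, factorSection_factorProduct hP hQ]
  -- Since `P h = 0` and `h Q = 0`, the section is constant along `h`, so `Φ` is affine on that line
  -- with slope `z`.
  · set h : Matrix (Fin m) (Fin n) ℝ := L₁ * φ.symm z * R₁ᵀ with hh
    have hPh : P * h = 0 := by rw [hh, ← Matrix.mul_assoc, ← Matrix.mul_assoc, hPL₁]; simp
    have hhQ : h * Q = 0 := by
      rw [hh, Matrix.mul_assoc, ← Matrix.transpose_transpose Q, ← Matrix.transpose_mul, hQR₁]
      simp
    have hline : ∀ t : ℝ, Φ (q + t • h) = Φ q + t • z := fun t ↦ by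
      have h1 : factorSection P Q (q + t • h) = factorSection P Q q := by
        simp [factorSection, Matrix.mul_add, Matrix.add_mul, hPh, hhQ]
      have h2 : P₁ * h * Q₁ᵀ = φ.symm z := by
        calc P₁ * h * Q₁ᵀ = (P₁ * L₁) * φ.symm z * (Q₁ * R₁)ᵀ := by
              rw [hh, Matrix.transpose_mul]; simp only [Matrix.mul_assoc]
          _ = φ.symm z := by rw [hPL₁', hQR₁']; simp
      simp only [Φ]
      rw [h1, add_sub_right_comm, Matrix.mul_add, Matrix.add_mul, map_add, Matrix.mul_smul,
        Matrix.smul_mul, h2, map_smul, φ.apply_symm_apply]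
    refine ⟨h, ?_⟩
    have h1 : HasDerivAt (fun t : ℝ ↦ q + t • h) h 0 := by
      have := ((hasDerivAt_id (0 : ℝ)).smul_const h).const_add q
      rwa [one_smul] at this
    have h2 : HasFDerivAt Φ (fderiv ℝ Φ q) (q + (0 : ℝ) • h) := by
      rw [zero_smul, add_zero]
      exact ((hΦ q hq).differentiableAt (by simp)).hasFDerivAt
    have h3 := h2.comp_hasDerivAt 0 h1
    have h4 : HasDerivAt (Φ ∘ fun t : ℝ ↦ q + t • h) z 0 := by
      rw [show (Φ ∘ fun t : ℝ ↦ q + t • h) = fun t ↦ Φ q + t • z from funext hline]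
      have := ((hasDerivAt_id (0 : ℝ)).smul_const z).const_add (Φ q)
      rwa [one_smul] at this
    exact h3.unique h4
  · ext q
    constructor
    · rintro ⟨⟨w, hw, rfl⟩, hV⟩
      exact ⟨hV, by simp [Φ, factorProduct_factorSection hV.1]⟩
    · rintro ⟨hqV, hq⟩
      refine ⟨⟨_, hqV.2, ?_⟩, hqV⟩
      set e := q - factorProduct m n k (factorSection P Q q) with he
      have hPe : P * e = 0 := by
        rw [he, factorProduct, factorSection, Matrix.mul_sub]
        simp only [WithLp.toLp_fst, WithLp.toLp_snd, ← Matrix.mul_assoc]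
        rw [Matrix.mul_nonsing_inv _ hqV.1, Matrix.one_mul, sub_self]
      have heQ : e * Q = 0 := by
        rw [he, factorProduct, factorSection, Matrix.sub_mul]
        simp only [WithLp.toLp_fst, WithLp.toLp_snd, Matrix.mul_assoc]
        have h1 : (P * (q * Q))⁻¹ * (P * (q * Q)) = 1 :=
          Matrix.nonsing_inv_mul _ (by rw [← Matrix.mul_assoc]; exact hqV.1)
        rw [h1, Matrix.mul_one, sub_self]
      have hmid : P₁ * e * Q₁ᵀ = 0 := φ.map_eq_zero_iff.1 hq
      have hRQ' : Q * y.snd + Q₁ᵀ * R₁ᵀ = 1 := by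
        have := congrArg Matrix.transpose hRQ
        simpa [Matrix.transpose_mul] using this
      have : e = 0 := by
        calc e = (y.fst * P + L₁ * P₁) * e * (Q * y.snd + Q₁ᵀ * R₁ᵀ) := by
              rw [hLP, hRQ', Matrix.one_mul, Matrix.mul_one]
          _ = y.fst * (P * e) * (Q * y.snd + Q₁ᵀ * R₁ᵀ) + L₁ * P₁ * (e * Q) * y.snd
              + L₁ * (P₁ * e * Q₁ᵀ) * R₁ᵀ := by
              simp only [Matrix.mul_add, Matrix.add_mul, Matrix.mul_assoc]
              abel
          _ = 0 := by rw [hPe, heQ, hmid]; simp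
      exact (sub_eq_zero.1 this).symm

theorem hasDerivAt_factorProduct_line (y d : FactorPair m n k) (t : ℝ) :
    HasDerivAt (fun t : ℝ ↦ factorProduct m n k (y + t • d))
      ((y + t • d).fst * d.snd + d.fst * (y + t • d).snd) t := by
  have h1 : HasDerivAt (fun t : ℝ ↦ y.fst + t • d.fst) d.fst t := by
    have h := ((hasDerivAt_id t).smul_const d.fst).const_add y.fst
    rwa [one_smul] at h
  have h2 : HasDerivAt (fun t : ℝ ↦ y.snd + t • d.snd) d.snd t := by
    have h := ((hasDerivAt_id t).smul_const d.snd).const_add y.snd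
    rwa [one_smul] at h
  exact h1.matrix_mul h2

/-- Within the products of factor pairs near `y`, the geodesic distance is asymptotically at most
the Euclidean distance. -/
theorem eventually_geodesicEDist_image_factorProduct_le {y : FactorPair m n k}
    (hy : y ∈ fullRankPairs m n k) {W : Set (FactorPair m n k)} (hW : W ∈ 𝓝 y) {ε : ℝ}
    (hε : 0 < ε) :
    ∀ᶠ x in 𝓝[range (factorProduct m n k)] (factorProduct m n k y),
      geodesicEDist (factorProduct m n k '' W) (factorProduct m n k y) x ≤
        ENNReal.ofReal ((1 + ε) * ‖x - factorProduct m n k y‖) := by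
  obtain ⟨P, hP⟩ := Matrix.exists_left_inverse_of_rank_eq hy.1
  obtain ⟨Q, hQ⟩ := Matrix.exists_right_inverse_of_rank_eq hy.2
  obtain ⟨δ, hδ, hball⟩ := Metric.mem_nhds_iff.1 hW
  have hd := ((contDiffAt_factorSection (N := 1)
    (isUnit_det_factorProduct hP hQ)).differentiableAt one_ne_zero).hasFDerivAt.isBigO_sub
  obtain ⟨C, hC0, hC⟩ := hd.exists_pos
  rw [factorSection_factorProduct hP hQ] at hC
  have hsmall : ∀ᶠ x in 𝓝 (factorProduct m n k y), C ^ 2 * ‖x - factorProduct m n k y‖ < ε := by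
    have hc : Continuous fun x ↦ C ^ 2 * ‖x - factorProduct m n k y‖ := by fun_prop
    exact hc.continuousAt.eventually_lt continuousAt_const (by simpa using hε)
  filter_upwards [eventually_factorProduct_factorSection hP hQ,
    ((tendsto_factorSection hP hQ).mono_left nhdsWithin_le_nhds (Metric.ball_mem_nhds y hδ)),
    hC.bound.filter_mono nhdsWithin_le_nhds, hsmall.filter_mono nhdsWithin_le_nhds]
    with x hx hxb hxC hxε
  set d := factorSection P Q x - y with hd
  have hyd : y + d = factorSection P Q x := by simp [hd]
  have hexp : x - factorProduct m n k y = y.fst * d.snd + d.fst * y.snd + d.fst * d.snd := by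
    rw [← hx, ← hyd]
    simp only [factorProduct, WithLp.add_fst, WithLp.add_snd, Matrix.add_mul, Matrix.mul_add]
    abel
  -- The competing curve is the image of the segment from `y` to the section at `x`.
  refine geodesicEDist_le_of_hasDerivAt (fun t ↦ factorProduct m n k (y + t • d)) _
    (hasDerivAt_factorProduct_line y d) ?_ (fun t ht ↦ ⟨_, hball ?_, rfl⟩) (by simp)
    (by simp [hyd, hx]) fun t ht ↦ ?_
  · have c1 : Continuous fun t : ℝ ↦ (y + t • d).fst :=
      (FactorPair.contDiff_fst (N := 0)).continuous.comp (by fun_prop)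
    have c2 : Continuous fun t : ℝ ↦ (y + t • d).snd :=
      (FactorPair.contDiff_snd (N := 0)).continuous.comp (by fun_prop)
    exact (c1.matrix_mul continuous_const).add (continuous_const.matrix_mul c2)
  · exact (convex_ball y δ).add_smul_sub_mem (Metric.mem_ball_self hδ) hxb ht
  -- The velocity differs from the chord by a term quadratic in `d`, with a coefficient of absolute
  -- value at most `1` on `[0, 1]`. As `‖d‖ ≤ C ‖x - x₀‖`, this term is absorbed by `ε`.
  · have e : (y + t • d).fst * d.snd + d.fst * (y + t • d).snd =
        (x - factorProduct m n k y) + (2 * t - 1) • (d.fst * d.snd) := by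
      rw [hexp]
      simp only [WithLp.add_fst, WithLp.add_snd, WithLp.smul_fst, WithLp.smul_snd, Matrix.add_mul,
        Matrix.mul_add, Matrix.smul_mul, Matrix.mul_smul]
      module
    have h1 : ‖d.fst * d.snd‖ ≤ ‖d‖ * ‖d‖ := (Matrix.frobenius_norm_mul _ _).trans
      (mul_le_mul (WithLp.norm_fst_le _ _) (WithLp.norm_snd_le _ _) (norm_nonneg _) (norm_nonneg _))
    have h2 : ‖(2 * t - 1) • (d.fst * d.snd)‖ ≤ ‖d.fst * d.snd‖ := by
      rw [norm_smul]
      exact mul_le_of_le_one_left (norm_nonneg _)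
        (by rw [Real.norm_eq_abs, abs_le]; constructor <;> linarith [ht.1, ht.2])
    have h3 : ‖d‖ * ‖d‖ ≤ C ^ 2 * ‖x - factorProduct m n k y‖ * ‖x - factorProduct m n k y‖ := by
      nlinarith [norm_nonneg d, norm_nonneg (x - factorProduct m n k y)]
    rw [e]
    refine (norm_add_le _ _).trans ?_
    nlinarith [norm_nonneg (x - factorProduct m n k y)]

end FactorPair

/-! ### The least-squares solution map -/

section LeastSquares

variable {m n k : ℕ}

/-- The obstruction to `y - y₀` being orthogonal at `y` to the fibre of `(L, R) ↦ L R`. -/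
def fiberResidual (y₀ y : FactorPair m n k) : Matrix (Fin k) (Fin k) ℝ :=
  y.fstᵀ * (y.fst - y₀.fst) - (y.snd - y₀.snd) * y.sndᵀ

/-- Two points of a fibre differ by `(L B, -B R')` with `B = A - 1`. The zero residual cancels the
first-order part of the change in squared distance to `y₀`, leaving a term quadratic in `B` with the
small factor `v`. It is dominated by `‖L B‖²` because `‖B‖ ≤ 2 ‖P‖ ‖L B‖`. The constant `8` is the
`2` of the cross term times the square of this `2`. -/
theorem FactorPair.norm_sub_lt_of_fiberResidual_eq_zero {y₀ y y' : FactorPair m n k}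
    {P : Matrix (Fin k) (Fin m) ℝ} {Q : Matrix (Fin n) (Fin k) ℝ} (hP : P * y₀.fst = 1)
    (hPy : IsUnit (P * y.fst).det) (hQy : IsUnit (y'.snd * Q).det)
    (h1 : ‖P‖ * ‖y.fst - y₀.fst‖ ≤ 1 / 2)
    (h2 : 8 * ‖P‖ ^ 2 * ‖y.snd - y₀.snd‖ * ‖y'.snd‖ < 1)
    (hres : fiberResidual y₀ y = 0) (hG : factorProduct m n k y = factorProduct m n k y')
    (hne : y' ≠ y) : ‖y - y₀‖ < ‖y' - y₀‖ := by
  simp only [factorProduct] at hG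
  -- The gauge matrix relating the two points: `L' = L A` and `R = A R'`. Stated this way, no
  -- inverse of `A` is needed.
  set A := y.snd * Q * (y'.snd * Q)⁻¹ with hA
  have hL : y'.fst = y.fst * A := by
    rw [hA, ← Matrix.mul_assoc, ← Matrix.mul_assoc, hG, Matrix.mul_assoc y'.fst,
      Matrix.mul_assoc y'.fst, Matrix.mul_nonsing_inv _ hQy, Matrix.mul_one]
  have hR : y.snd = A * y'.snd := by
    have h : P * y.fst * y.snd = P * y.fst * (A * y'.snd) := by
      rw [Matrix.mul_assoc, hG, hL]
      simp only [Matrix.mul_assoc]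
    have h' := congrArg (fun M ↦ (P * y.fst)⁻¹ * M) h
    simpa only [← Matrix.mul_assoc, Matrix.nonsing_inv_mul _ hPy, Matrix.one_mul] using h'
  set B := A - 1 with hB
  have hLB : y'.fst - y.fst = y.fst * B := by rw [hL, hB, Matrix.mul_sub, Matrix.mul_one]
  have hRB : y'.snd - y.snd = -(B * y'.snd) := by
    rw [hB, Matrix.sub_mul, ← hR, Matrix.one_mul, neg_sub]
  set u := y.fst - y₀.fst with hu
  set v := y.snd - y₀.snd with hv
  have hB1 : ‖B‖ ≤ 2 * ‖P‖ * ‖y.fst * B‖ := by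
    -- `P` inverts `y₀.fst` and not `y.fst`; the error `P u` has norm at most `1 / 2` and is
    -- absorbed.
    have e : B = P * (y.fst * B) - P * (u * B) := by
      rw [← Matrix.mul_sub, ← Matrix.sub_mul, hu, sub_sub_cancel, ← Matrix.mul_assoc, hP,
        Matrix.one_mul]
    have e1 : ‖B‖ ≤ ‖P * (y.fst * B)‖ + ‖P * (u * B)‖ := by
      conv_lhs => rw [e]
      exact norm_sub_le _ _
    have e2 : ‖P * (y.fst * B)‖ ≤ ‖P‖ * ‖y.fst * B‖ := Matrix.frobenius_norm_mul _ _
    have e3 : ‖P * (u * B)‖ ≤ 1 / 2 * ‖B‖ := by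
      calc ‖P * (u * B)‖ ≤ ‖P * u‖ * ‖B‖ := by
            rw [← Matrix.mul_assoc]; exact Matrix.frobenius_norm_mul _ _
        _ ≤ ‖P‖ * ‖u‖ * ‖B‖ := by gcongr; exact Matrix.frobenius_norm_mul _ _
        _ ≤ 1 / 2 * ‖B‖ := by gcongr
    linarith
  have hpos : 0 < ‖y.fst * B‖ := by
    refine (norm_nonneg _).lt_of_ne' fun h0 ↦ hne ?_
    rw [h0, mul_zero] at hB1
    have hB0 : B = 0 := norm_le_zero_iff.1 hB1
    rw [hB0, Matrix.mul_zero, sub_eq_zero] at hLB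
    rw [hB0, Matrix.zero_mul, neg_zero, sub_eq_zero] at hRB
    exact WithLp.ofLp_injective 2 (Prod.ext hLB hRB)
  have hcrit : (uᵀ * (y.fst * B)).trace = (vᵀ * (B * y.snd)).trace := by
    have h := sub_eq_zero.1 hres
    have h' := congrArg (fun M ↦ (Mᵀ * B).trace) h
    simp only [Matrix.transpose_mul, Matrix.transpose_transpose, ← hu, ← hv] at h'
    rw [← Matrix.mul_assoc, h', Matrix.mul_assoc, Matrix.trace_mul_comm, Matrix.mul_assoc]
  have hcross : (uᵀ * (y.fst * B)).trace + (vᵀ * -(B * y'.snd)).trace =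
      (vᵀ * (B * B * y'.snd)).trace := by
    rw [hcrit, ← Matrix.trace_add, ← Matrix.mul_add, hR, Matrix.mul_assoc B B, hB]
    simp only [Matrix.sub_mul, Matrix.mul_sub, Matrix.mul_add, Matrix.mul_neg, Matrix.one_mul]
    congr 1
  have hbound : |(vᵀ * (B * B * y'.snd)).trace| ≤ ‖v‖ * ‖y'.snd‖ * ‖B‖ ^ 2 := by
    calc _ ≤ ‖v‖ * ‖B * B * y'.snd‖ := Matrix.abs_trace_transpose_mul_le _ _
      _ ≤ ‖v‖ * (‖B * B‖ * ‖y'.snd‖) := by gcongr; exact Matrix.frobenius_norm_mul _ _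
      _ ≤ ‖v‖ * (‖B‖ * ‖B‖ * ‖y'.snd‖) := by gcongr; exact Matrix.frobenius_norm_mul _ _
      _ = _ := by ring
  have hy : ‖y - y₀‖ ^ 2 = ‖u‖ ^ 2 + ‖v‖ ^ 2 := WithLp.prod_norm_sq_eq_of_L2 _
  have hy' : ‖y' - y₀‖ ^ 2 = ‖u + y.fst * B‖ ^ 2 + ‖v + -(B * y'.snd)‖ ^ 2 := by
    rw [← hLB, ← hRB, hu, hv, add_comm (_ - _), add_comm (y.snd - _), sub_add_sub_cancel,
      sub_add_sub_cancel]
    exact WithLp.prod_norm_sq_eq_of_L2 _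
  rw [Matrix.frobenius_norm_add_sq, Matrix.frobenius_norm_add_sq] at hy'
  refine lt_of_pow_lt_pow_left₀ 2 (norm_nonneg _) ?_
  have hB2 : ‖B‖ ^ 2 ≤ 4 * ‖P‖ ^ 2 * ‖y.fst * B‖ ^ 2 := by
    calc ‖B‖ ^ 2 ≤ (2 * ‖P‖ * ‖y.fst * B‖) ^ 2 := by gcongr
      _ = _ := by ring
  have hfin : 2 * (‖v‖ * ‖y'.snd‖ * ‖B‖ ^ 2) < ‖y.fst * B‖ ^ 2 := by
    calc 2 * (‖v‖ * ‖y'.snd‖ * ‖B‖ ^ 2)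
        ≤ 2 * (‖v‖ * ‖y'.snd‖ * (4 * ‖P‖ ^ 2 * ‖y.fst * B‖ ^ 2)) := by gcongr
      _ = (8 * ‖P‖ ^ 2 * ‖v‖ * ‖y'.snd‖) * ‖y.fst * B‖ ^ 2 := by ring
      _ < 1 * ‖y.fst * B‖ ^ 2 := by gcongr
      _ = _ := one_mul _
  have := (abs_le.1 hbound).1
  nlinarith [sq_nonneg ‖-(B * y'.snd)‖]

/-- Near `y₀`, a factor pair with vanishing residual is the unique nearest point to `y₀` in its
fibre. -/
theorem exists_ball_norm_sub_lt_of_fiberResidual_eq_zero {y₀ : FactorPair m n k}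
    (hy₀ : y₀ ∈ fullRankPairs m n k) :
    ∃ δ > 0, ∀ y ∈ Metric.ball y₀ δ, ∀ y' ∈ Metric.ball y₀ δ, fiberResidual y₀ y = 0 →
      factorProduct m n k y = factorProduct m n k y' → y' ≠ y → ‖y - y₀‖ < ‖y' - y₀‖ := by
  obtain ⟨P, hP⟩ := Matrix.exists_left_inverse_of_rank_eq hy₀.1
  obtain ⟨Q, hQ⟩ := Matrix.exists_right_inverse_of_rank_eq hy₀.2
  have c1 : Continuous fun y : FactorPair m n k ↦ y.fst :=
    (FactorPair.contDiff_fst (N := 0)).continuous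
  have c2 : Continuous fun y : FactorPair m n k ↦ y.snd :=
    (FactorPair.contDiff_snd (N := 0)).continuous
  have e1 : ∀ᶠ y in 𝓝 y₀, IsUnit (P * y.fst).det :=
    (isOpen_setOf_isUnit_det (continuous_const.matrix_mul c1)).mem_nhds (by simp [hP])
  have e2 : ∀ᶠ y in 𝓝 y₀, IsUnit (y.snd * Q).det :=
    (isOpen_setOf_isUnit_det (c2.matrix_mul continuous_const)).mem_nhds (by simp [hQ])
  have e3 : ∀ᶠ y in 𝓝 y₀, ‖P‖ * ‖y.fst - y₀.fst‖ < 1 / 2 := by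
    have hc : Continuous fun y : FactorPair m n k ↦ ‖P‖ * ‖y.fst - y₀.fst‖ := by fun_prop
    exact hc.continuousAt.eventually_lt continuousAt_const (by simp)
  have e4 : ∀ᶠ y in 𝓝 y₀, 8 * ‖P‖ ^ 2 * ‖y.snd - y₀.snd‖ * (‖y₀.snd‖ + 1) < 1 := by
    have hc : Continuous fun y : FactorPair m n k ↦
      8 * ‖P‖ ^ 2 * ‖y.snd - y₀.snd‖ * (‖y₀.snd‖ + 1) := by fun_prop
    exact hc.continuousAt.eventually_lt continuousAt_const (by simp)
  have e5 : ∀ᶠ y in 𝓝 y₀, ‖y.snd‖ < ‖y₀.snd‖ + 1 :=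
    c2.norm.continuousAt.eventually_lt continuousAt_const (by simp)
  obtain ⟨δ, hδ, h⟩ := Metric.eventually_nhds_iff_ball.1
    (e1.and (e2.and (e3.and (e4.and e5))))
  refine ⟨δ, hδ, fun y hy y' hy' hres hG hne ↦ ?_⟩
  obtain ⟨a1, -, a3, a4, -⟩ := h y hy
  obtain ⟨-, b2, -, -, b5⟩ := h y' hy'
  refine FactorPair.norm_sub_lt_of_fiberResidual_eq_zero hP a1 b2 a3.le (lt_of_le_of_lt ?_ a4)
    hres hG hne
  gcongr

/-- The action of `A` on factor pairs that leaves the product unchanged. -/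
noncomputable def gaugeAction (A : Matrix (Fin k) (Fin k) ℝ) (y : FactorPair m n k) : FactorPair m n k :=
  WithLp.toLp 2 (y.fst * A, A⁻¹ * y.snd)

theorem factorProduct_gaugeAction {A : Matrix (Fin k) (Fin k) ℝ} (hA : IsUnit A.det)
    (y : FactorPair m n k) : factorProduct m n k (gaugeAction A y) = factorProduct m n k y := by
  simp only [factorProduct, gaugeAction, WithLp.toLp_fst, WithLp.toLp_snd]
  rw [Matrix.mul_assoc, ← Matrix.mul_assoc A, Matrix.mul_nonsing_inv _ hA, Matrix.one_mul]

theorem gaugeAction_one (y : FactorPair m n k) : gaugeAction 1 y = y := by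
  simp only [gaugeAction, inv_one, Matrix.mul_one, Matrix.one_mul]
  rfl

/-- Obtained by differentiating `M⁻¹ * M = 1`. -/
theorem hasDerivAt_matrix_one_add_smul_inv (B : Matrix (Fin k) (Fin k) ℝ) :
    HasDerivAt (fun t : ℝ ↦ (1 + t • B)⁻¹) (-B) 0 := by
  have h1 : HasDerivAt (fun t : ℝ ↦ 1 + t • B) B 0 := by
    have h := ((hasDerivAt_id (0 : ℝ)).smul_const B).const_add 1
    rwa [one_smul] at h
  have hc : ContDiff ℝ 1 (fun t : ℝ ↦ 1 + t • B) :=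
    contDiff_const.add (contDiff_id.smul contDiff_const)
  have h2 : DifferentiableAt ℝ (fun t : ℝ ↦ (1 + t • B)⁻¹) 0 :=
    (hc.contDiffAt.matrix_inv (by simp)).differentiableAt one_ne_zero
  have h3 := h2.hasDerivAt.matrix_mul h1
  have h4 : (fun t : ℝ ↦ (1 + t • B)⁻¹ * (1 + t • B)) =ᶠ[𝓝 0] fun _ ↦ 1 := by
    filter_upwards [(isOpen_setOf_isUnit_det hc.continuous).mem_nhds
      (show IsUnit (1 + (0 : ℝ) • B).det by simp)] with t ht
    exact Matrix.nonsing_inv_mul _ ht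
  have h5 := h3.unique ((hasDerivAt_const (0 : ℝ) 1).congr_of_eventuallyEq h4)
  simp only [zero_smul, add_zero, inv_one, Matrix.one_mul, Matrix.mul_one] at h5
  rw [← eq_neg_of_add_eq_zero_right h5]
  exact h2.hasDerivAt

/-- At `t = 0` both differences in the residual vanish, so only the terms in which a difference is
differentiated survive. This is the partial derivative needed for the implicit function theorem. -/
theorem hasDerivAt_fiberResidual_gaugeAction (y : FactorPair m n k)
    (B : Matrix (Fin k) (Fin k) ℝ) :
    HasDerivAt (fun t : ℝ ↦ fiberResidual y (gaugeAction (1 + t • B) y))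
      (y.fstᵀ * (y.fst * B) + B * y.snd * y.sndᵀ) 0 := by
  have h1 : HasDerivAt (fun t : ℝ ↦ 1 + t • B) B 0 := by
    have h := ((hasDerivAt_id (0 : ℝ)).smul_const B).const_add 1
    rwa [one_smul] at h
  have hL := (hasDerivAt_const (0 : ℝ) y.fst).matrix_mul h1
  have hR := (hasDerivAt_matrix_one_add_smul_inv B).matrix_mul (hasDerivAt_const (0 : ℝ) y.snd)
  have hLt : HasDerivAt (fun t : ℝ ↦ (y.fst * (1 + t • B))ᵀ) _ 0 :=
    (Matrix.transposeCLM _ _).hasFDerivAt.comp_hasDerivAt 0 hL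
  have hRt : HasDerivAt (fun t : ℝ ↦ ((1 + t • B)⁻¹ * y.snd)ᵀ) _ 0 :=
    (Matrix.transposeCLM _ _).hasFDerivAt.comp_hasDerivAt 0 hR
  have h := (hLt.matrix_mul (hL.sub_const y.fst)).sub ((hR.sub_const y.snd).matrix_mul hRt)
  refine h.congr_deriv ?_
  simp [Matrix.mul_assoc]

/-- The local solution map of `L R = x` with vanishing residual. -/
theorem exists_contDiffAt_fiberResidual_eq_zero {y₀ : FactorPair m n k}
    (hy₀ : y₀ ∈ fullRankPairs m n k) :
    ∃ H : Matrix (Fin m) (Fin n) ℝ → FactorPair m n k,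
      ContDiffAt ℝ ω H (factorProduct m n k y₀) ∧ H (factorProduct m n k y₀) = y₀ ∧
      (∀ᶠ x in 𝓝[range (factorProduct m n k)] (factorProduct m n k y₀),
        factorProduct m n k (H x) = x) ∧
      ∀ᶠ x in 𝓝 (factorProduct m n k y₀), fiberResidual y₀ (H x) = 0 := by
  obtain ⟨P, hP⟩ := Matrix.exists_left_inverse_of_rank_eq hy₀.1
  obtain ⟨Q, hQ⟩ := Matrix.exists_right_inverse_of_rank_eq hy₀.2
  have := FiniteDimensional.complete ℝ (Matrix (Fin m) (Fin n) ℝ)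
  have := FiniteDimensional.complete ℝ (Matrix (Fin k) (Fin k) ℝ)
  set x₀ := factorProduct m n k y₀ with hx₀
  have hs₀ : factorSection P Q x₀ = y₀ := factorSection_factorProduct hP hQ
  let u : Matrix (Fin m) (Fin n) ℝ × Matrix (Fin k) (Fin k) ℝ := (x₀, 1)
  let g : Matrix (Fin m) (Fin n) ℝ × Matrix (Fin k) (Fin k) ℝ → FactorPair m n k :=
    fun p ↦ gaugeAction p.2 (factorSection P Q p.1)
  have hg : ∀ p, IsUnit (P * p.1 * Q).det → IsUnit p.2.det → ContDiffAt ℝ ω g p := by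
    intro p hp1 hp2
    have hs : ContDiffAt ℝ ω (fun p : Matrix (Fin m) (Fin n) ℝ × Matrix (Fin k) (Fin k) ℝ ↦
        factorSection P Q p.1) p := (contDiffAt_factorSection hp1).comp p contDiffAt_fst
    exact ((FactorPair.contDiff_fst.contDiffAt.comp p hs).matrix_mul contDiffAt_snd).toLp_prodMk
      ((contDiffAt_snd.matrix_inv hp2).matrix_mul (FactorPair.contDiff_snd.contDiffAt.comp p hs))
  have hgu : g u = y₀ := by simp only [g, u, gaugeAction_one, hs₀]
  have hgu' : ContDiffAt ℝ ω g u := hg u (isUnit_det_factorProduct hP hQ) (by simp [u])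
  -- The section supplies one solution for each `x`; the equation `f (x, A) = 0` is then solved for
  -- the gauge matrix `A` near `1`.
  let f : Matrix (Fin m) (Fin n) ℝ × Matrix (Fin k) (Fin k) ℝ → Matrix (Fin k) (Fin k) ℝ :=
    fun p ↦ fiberResidual y₀ (g p)
  have hf : ContDiffAt ℝ ω f u := by
    have a1 := FactorPair.contDiff_fst.contDiffAt.comp u hgu'
    have a2 := FactorPair.contDiff_snd.contDiffAt.comp u hgu'
    exact (a1.matrix_transpose.matrix_mul (a1.sub contDiffAt_const)).sub
      ((a2.sub contDiffAt_const).matrix_mul a2.matrix_transpose)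
  have hfu : f u = 0 := by simp [f, hgu, fiberResidual]
  set S := fderiv ℝ f u ∘L .inr ℝ (Matrix (Fin m) (Fin n) ℝ) (Matrix (Fin k) (Fin k) ℝ) with hS
  have hSB : ∀ B, S B = y₀.fstᵀ * (y₀.fst * B) + B * y₀.snd * y₀.sndᵀ := fun B ↦ by
    have h1 : HasDerivAt (fun t : ℝ ↦ u + t • ((0, B) : _ × _)) (0, B) 0 := by
      have h := ((hasDerivAt_id (0 : ℝ)).smul_const
        ((0, B) : Matrix (Fin m) (Fin n) ℝ × Matrix (Fin k) (Fin k) ℝ)).const_add u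
      rwa [one_smul] at h
    have h2 : HasFDerivAt f (fderiv ℝ f u)
        (u + (0 : ℝ) • ((0, B) : Matrix (Fin m) (Fin n) ℝ × Matrix (Fin k) (Fin k) ℝ)) := by
      rw [zero_smul, add_zero]
      exact (hf.differentiableAt (by simp)).hasFDerivAt
    have h3 := h2.comp_hasDerivAt 0 h1
    refine h3.unique ((hasDerivAt_fiberResidual_gaugeAction y₀ B).congr_of_eventuallyEq ?_)
    refine Eventually.of_forall fun t ↦ ?_
    simp [f, g, u, hs₀]
  -- `S` is positive definite: the inner product of `B` with `S B` is `‖L B‖² + ‖B R‖²`.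
  have hSinj : Function.Injective S := by
    refine (injective_iff_map_eq_zero S).2 fun B hB ↦ ?_
    have h1 : (Bᵀ * S B).trace = ‖y₀.fst * B‖ ^ 2 + ‖B * y₀.snd‖ ^ 2 := by
      rw [hSB, Matrix.mul_add, Matrix.trace_add, Matrix.frobenius_norm_sq_eq_trace,
        Matrix.frobenius_norm_sq_eq_trace, Matrix.transpose_mul, Matrix.transpose_mul,
        Matrix.mul_assoc Bᵀ, Matrix.mul_assoc y₀.sndᵀ, Matrix.trace_mul_comm y₀.sndᵀ]
      simp only [Matrix.mul_assoc]
    rw [hB, Matrix.mul_zero, Matrix.trace_zero] at h1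
    have h2 : y₀.fst * B = 0 := by
      rw [← norm_eq_zero]
      nlinarith [sq_nonneg ‖y₀.fst * B‖, sq_nonneg ‖B * y₀.snd‖]
    rw [← Matrix.one_mul B, ← hP, Matrix.mul_assoc, h2, Matrix.mul_zero]
  have hSinv : S.IsInvertible :=
    ⟨(LinearEquiv.ofInjectiveEndo S.toLinearMap hSinj).toContinuousLinearEquiv, by ext; rfl⟩
  have hω : (ω : ℕ∞ω) ≠ 0 := by simp
  set α := hf.implicitFunction hω hSinv with hα
  have hα0 : α x₀ = 1 := hf.implicitFunction_apply_self hω hSinv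
  have hαc : ContDiffAt ℝ ω α x₀ := hf.contDiffAt_implicitFunction hω hSinv
  have hαe : ∀ᶠ x in 𝓝 x₀, f (x, α x) = 0 := by
    have := hf.eventually_apply_implicitFunction hω hSinv
    rwa [hfu] at this
  refine ⟨fun x ↦ g (x, α x), ?_, ?_, ?_, hαe⟩
  · refine ContDiffAt.comp x₀ (g := g) ?_ (contDiffAt_id.prodMk hαc)
    simpa only [hα0, id] using hgu'
  · change g (x₀, α x₀) = y₀
    rw [hα0]
    exact hgu
  · have hdet : ∀ᶠ x in 𝓝 x₀, IsUnit (α x).det := by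
      refine hαc.continuousAt.eventually_mem ((isOpen_setOf_isUnit_det continuous_id).mem_nhds ?_)
      simp [hα0]
    filter_upwards [eventually_factorProduct_factorSection hP hQ,
      hdet.filter_mono nhdsWithin_le_nhds] with x hx hxd
    simp only [g]
    rw [factorProduct_gaugeAction hxd, hx]

end LeastSquares

/-! ### Reduction of the condition number to the Euclidean distance -/

section Reduction

variable {m n k : ℕ}

/-- `H` is, near the product of `y₀`, a solution map of `L R = x` with vanishing residual. -/
structure IsLocalSolutionMap (y₀ : FactorPair m n k)
    (H : Matrix (Fin m) (Fin n) ℝ → FactorPair m n k) : Prop where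
  contDiffAt : ContDiffAt ℝ ω H (factorProduct m n k y₀)
  apply_self : H (factorProduct m n k y₀) = y₀
  eventually_factorProduct : ∀ᶠ x in 𝓝[range (factorProduct m n k)] (factorProduct m n k y₀),
    factorProduct m n k (H x) = x
  eventually_fiberResidual : ∀ᶠ x in 𝓝 (factorProduct m n k y₀), fiberResidual y₀ (H x) = 0

theorem exists_isLocalSolutionMap {y₀ : FactorPair m n k} (hy₀ : y₀ ∈ fullRankPairs m n k) :
    ∃ H, IsLocalSolutionMap y₀ H := by
  obtain ⟨H, h1, h2, h3, h4⟩ := exists_contDiffAt_fiberResidual_eq_zero hy₀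
  exact ⟨H, h1, h2, h3, h4⟩

theorem IsLocalSolutionMap.tendsto {y₀ : FactorPair m n k}
    {H : Matrix (Fin m) (Fin n) ℝ → FactorPair m n k} (hH : IsLocalSolutionMap y₀ H) :
    Tendsto H (𝓝 (factorProduct m n k y₀)) (𝓝 y₀) := by
  have := hH.contDiffAt.continuousAt
  rwa [ContinuousAt, hH.apply_self] at this

/-- `κ` is a first-order error bound for `H` at the product of `y₀` for Euclidean distances. -/
def IsEuclideanErrorBound (y₀ : FactorPair m n k)
    (H : Matrix (Fin m) (Fin n) ℝ → FactorPair m n k) (κ : ℝ) : Prop :=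
  ∀ ε > 0, ∀ᶠ x in 𝓝[range (factorProduct m n k)] (factorProduct m n k y₀),
    ‖H x - y₀‖ ≤ (κ + ε) * ‖x - factorProduct m n k y₀‖

theorem IsEuclideanErrorBound.congr {y₀ : FactorPair m n k}
    {H H' : Matrix (Fin m) (Fin n) ℝ → FactorPair m n k} {κ : ℝ}
    (h : IsEuclideanErrorBound y₀ H κ)
    (hHH' : H =ᶠ[𝓝[range (factorProduct m n k)] (factorProduct m n k y₀)] H') :
    IsEuclideanErrorBound y₀ H' κ := fun ε hε ↦ by
  filter_upwards [h ε hε, hHH'] with x hx hx'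
  rwa [← hx']

/-- The product is open onto its range near `y₀`, so every admissible choice of `W` and `U` gives
the same filter. This removes the dependence of the condition number on these choices. -/
theorem nhdsWithin_eq_nhdsWithin_range_factorProduct {y₀ : FactorPair m n k}
    (hy₀ : y₀ ∈ fullRankPairs m n k) {W : Set (FactorPair m n k)} (hW : W ∈ 𝓝 y₀)
    {U : Set (Matrix (Fin m) (Fin n) ℝ)} (hUX : U ⊆ factorProduct m n k '' W)
    (hU : U ∈ 𝓝[factorProduct m n k '' W] (factorProduct m n k y₀)) :
    𝓝[U] (factorProduct m n k y₀) = 𝓝[range (factorProduct m n k)] (factorProduct m n k y₀) :=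
  le_antisymm (nhdsWithin_mono _ (hUX.trans (image_subset_range _ _)))
    ((nhdsWithin_le_of_mem (image_factorProduct_mem_nhdsWithin hy₀ hW)).trans
      (nhdsWithin_le_of_mem hU))

theorem geodesicEDist_eq_of_mem_ball {E : Type*} [NormedAddCommGroup E] [NormedSpace ℝ E]
    {W : Set E} {y z : E} {r : ℝ} (hW : Metric.ball y r ⊆ W) (hz : z ∈ Metric.ball y r) :
    geodesicEDist W y z = ENNReal.ofReal ‖z - y‖ := by
  rw [geodesicEDist_eq_of_segment, ofReal_norm]
  exact ((convex_ball y r).segment_subset (Metric.mem_ball_self (Metric.pos_of_mem_ball hz))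
    hz).trans hW

/-- In `W` the geodesic distance from `y₀` is Euclidean on a ball. In the image it lies between the
Euclidean distance and `1 + η` times it, for any `η > 0` close enough to the base point. -/
theorem isFirstOrderErrorBound_iff_isEuclideanErrorBound {y₀ : FactorPair m n k}
    (hy₀ : y₀ ∈ fullRankPairs m n k) {W : Set (FactorPair m n k)} (hW : W ∈ 𝓝 y₀)
    {U : Set (Matrix (Fin m) (Fin n) ℝ)} (hUX : U ⊆ factorProduct m n k '' W)
    (hU : U ∈ 𝓝[factorProduct m n k '' W] (factorProduct m n k y₀))
    {H : Matrix (Fin m) (Fin n) ℝ → FactorPair m n k} (hH₀ : H (factorProduct m n k y₀) = y₀)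
    (hH : Tendsto H (𝓝[range (factorProduct m n k)] (factorProduct m n k y₀)) (𝓝 y₀))
    {κ : ℝ} (hκ : 0 ≤ κ) :
    IsFirstOrderErrorBound (factorProduct m n k '' W) U W H (factorProduct m n k y₀) κ ↔
      IsEuclideanErrorBound y₀ H κ := by
  obtain ⟨r, hr, hball⟩ := Metric.mem_nhds_iff.1 hW
  change (∀ ε > 0, ∀ᶠ x in 𝓝[U] (factorProduct m n k y₀),
    geodesicEDist W (H (factorProduct m n k y₀)) (H x) ≤ ENNReal.ofReal (κ + ε) *
      geodesicEDist (factorProduct m n k '' W) (factorProduct m n k y₀) x) ↔ _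
  rw [nhdsWithin_eq_nhdsWithin_range_factorProduct hy₀ hW hUX hU, hH₀]
  have hHball := hH (Metric.ball_mem_nhds y₀ hr)
  constructor
  · intro h ε hε
    -- This value `η` satisfies `(κ + ε / 2) * (1 + η) = κ + ε`.
    have hη : 0 < ε / 2 / (κ + ε / 2) := by positivity
    filter_upwards [h (ε / 2) (by positivity), hHball,
      eventually_geodesicEDist_image_factorProduct_le hy₀ hW hη] with x h1 h2 h3
    rw [geodesicEDist_eq_of_mem_ball hball h2] at h1
    have h4 := h1.trans (mul_le_mul_right h3 _)
    rw [← ENNReal.ofReal_mul (by positivity), ENNReal.ofReal_le_ofReal_iff (by positivity)] at h4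
    refine h4.trans_eq ?_
    field_simp
    ring
  · intro h ε hε
    filter_upwards [h ε hε, hHball] with x h1 h2
    rw [geodesicEDist_eq_of_mem_ball hball h2]
    calc ENNReal.ofReal ‖H x - y₀‖
        ≤ ENNReal.ofReal ((κ + ε) * ‖x - factorProduct m n k y₀‖) := ENNReal.ofReal_le_ofReal h1
      _ = ENNReal.ofReal (κ + ε) * ‖x - factorProduct m n k y₀‖ₑ := by
          rw [ENNReal.ofReal_mul (by positivity), ofReal_norm]
      _ ≤ _ := mul_le_mul_right (enorm_sub_le_geodesicEDist _ _ _) _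

/-- `y₀` is itself a solution, at distance zero, so no other point can be strictly closer. -/
theorem IsLeastSquaresSolutionMap.apply_factorProduct {y₀ : FactorPair m n k}
    {W : Set (FactorPair m n k)} (hW : y₀ ∈ W) {U : Set (Matrix (Fin m) (Fin n) ℝ)}
    (hU : factorProduct m n k y₀ ∈ U) {H : Matrix (Fin m) (Fin n) ℝ → FactorPair m n k}
    (hH : IsLeastSquaresSolutionMap (fun x y ↦ factorProduct m n k y - x) 0 U W y₀ H) :
    H (factorProduct m n k y₀) = y₀ := by
  by_contra hne
  have h := (hH.2 _ hU).2.2 y₀ hW (sub_self _) (Ne.symm hne)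
  rw [geodesicEDist_eq_of_segment (y := y₀) (by simpa using hW)] at h
  rw [← ofReal_norm, sub_self, norm_zero, ENNReal.ofReal_zero] at h
  exact not_lt_bot h

/-- A least-squares solution map agrees near the base point with the local solution map. -/
theorem IsLeastSquaresSolutionMap.eventuallyEq {y₀ : FactorPair m n k}
    (hy₀ : y₀ ∈ fullRankPairs m n k) {W : Set (FactorPair m n k)} (hW : W ∈ 𝓝 y₀)
    {U : Set (Matrix (Fin m) (Fin n) ℝ)} (hUX : U ⊆ factorProduct m n k '' W)
    (hU : U ∈ 𝓝[factorProduct m n k '' W] (factorProduct m n k y₀))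
    {H H₀ : Matrix (Fin m) (Fin n) ℝ → FactorPair m n k}
    (hH : IsLeastSquaresSolutionMap (fun x y ↦ factorProduct m n k y - x) 0 U W y₀ H)
    (hH₀ : IsLocalSolutionMap y₀ H₀) :
    H =ᶠ[𝓝[range (factorProduct m n k)] (factorProduct m n k y₀)] H₀ := by
  have hx₀U : factorProduct m n k y₀ ∈ U :=
    mem_of_mem_nhdsWithin (mem_image_of_mem _ (mem_of_mem_nhds hW)) hU
  obtain ⟨δ, hδ, huniq⟩ := exists_ball_norm_sub_lt_of_fiberResidual_eq_zero hy₀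
  obtain ⟨r, hr, hball⟩ := Metric.mem_nhds_iff.1 (inter_mem hW (Metric.ball_mem_nhds y₀ hδ))
  have hHc := hH.1.continuousOn.continuousWithinAt hx₀U
  rw [ContinuousWithinAt, hH.apply_factorProduct (mem_of_mem_nhds hW) hx₀U] at hHc
  have hHU : ∀ᶠ x in 𝓝[U] (factorProduct m n k y₀), x ∈ U ∧ H x ∈ Metric.ball y₀ r :=
    eventually_mem_nhdsWithin.and (hHc (Metric.ball_mem_nhds y₀ hr))
  rw [nhdsWithin_eq_nhdsWithin_range_factorProduct hy₀ hW hUX hU] at hHU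
  filter_upwards [hHU, hH₀.eventually_factorProduct,
    hH₀.eventually_fiberResidual.filter_mono nhdsWithin_le_nhds,
    hH₀.tendsto.mono_left nhdsWithin_le_nhds (Metric.ball_mem_nhds y₀ hr)]
    with x ⟨hxU, hxr⟩ h1 h2 h3
  -- If the two maps differed at `x`, each value would be strictly closer to `y₀` than the other: `H
  -- x` by minimality, `H₀ x` by its zero residual.
  by_contra hne
  obtain ⟨-, hGx, hmin⟩ := hH.2 x hxU
  have hlt := hmin (H₀ x) (hball h3).1 (by simp [h1]) (Ne.symm hne)
  rw [geodesicEDist_eq_of_mem_ball (fun z hz ↦ (hball hz).1) hxr,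
    geodesicEDist_eq_of_mem_ball (fun z hz ↦ (hball hz).1) h3] at hlt
  have hlt' := (ENNReal.ofReal_lt_ofReal_iff_of_nonneg (norm_nonneg _)).1 hlt
  refine hlt'.not_gt (huniq _ (hball h3).2 _ (hball hxr).2 h2 ?_ hne)
  rw [h1, sub_eq_zero.1 hGx]

/-- The local solution map is a least-squares solution map for a small neighbourhood of `y₀`. -/
theorem IsLocalSolutionMap.exists_isLeastSquaresSolutionMap {y₀ : FactorPair m n k}
    (hy₀ : y₀ ∈ fullRankPairs m n k) {H : Matrix (Fin m) (Fin n) ℝ → FactorPair m n k}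
    (hH : IsLocalSolutionMap y₀ H) :
    ∃ V : Set (FactorPair m n k), IsOpen V ∧ y₀ ∈ V ∧
      ∃ U ⊆ factorProduct m n k '' (fullRankPairs m n k ∩ V),
        U ∈ 𝓝[factorProduct m n k '' (fullRankPairs m n k ∩ V)] (factorProduct m n k y₀) ∧
        IsLeastSquaresSolutionMap (fun x y ↦ factorProduct m n k y - x) 0 U
          (fullRankPairs m n k ∩ V) y₀ H := by
  obtain ⟨δ, hδ, huniq⟩ := exists_ball_norm_sub_lt_of_fiberResidual_eq_zero hy₀
  obtain ⟨r, hr, hball⟩ := Metric.mem_nhds_iff.1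
    (inter_mem (isOpen_fullRankPairs.mem_nhds hy₀) (Metric.ball_mem_nhds y₀ hδ))
  set V := Metric.ball y₀ r with hV
  have hVW : V ⊆ fullRankPairs m n k ∩ V := fun z hz ↦ ⟨(hball hz).1, hz⟩
  refine ⟨V, Metric.isOpen_ball, Metric.mem_ball_self hr,
    -- `U` collects the points where all the local properties of `H` hold; each holds eventually
    -- near the base point.
    {x ∈ factorProduct m n k '' (fullRankPairs m n k ∩ V) | H x ∈ V ∧ factorProduct m n k (H x) = x ∧
      fiberResidual y₀ (H x) = 0 ∧ ContDiffAt ℝ ω H x}, fun x hx ↦ hx.1, ?_, ?_, ?_⟩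
  · have hmono := nhdsWithin_mono (factorProduct m n k y₀)
      (image_subset_range (factorProduct m n k) (fullRankPairs m n k ∩ V))
    filter_upwards [self_mem_nhdsWithin, hH.eventually_factorProduct.filter_mono hmono,
      hH.eventually_fiberResidual.filter_mono nhdsWithin_le_nhds,
      (hH.contDiffAt.eventually (by simp)).filter_mono nhdsWithin_le_nhds,
      hH.tendsto.mono_left nhdsWithin_le_nhds (Metric.ball_mem_nhds y₀ hr)] with x h1 h2 h3 h4 h5
    exact ⟨h1, h5, h2, h3, h4⟩
  · rintro x ⟨-, -, -, -, hx⟩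
    exact (hx.of_le le_top).contDiffWithinAt
  · rintro x ⟨-, h1, h2, h3, -⟩
    refine ⟨hVW h1, by simp [h2], fun y' hy' hGy' hne ↦ ?_⟩
    rw [geodesicEDist_eq_of_mem_ball hVW h1, geodesicEDist_eq_of_mem_ball hVW hy'.2]
    refine (ENNReal.ofReal_lt_ofReal_iff_of_nonneg (norm_nonneg _)).2
      (huniq _ (hball h1).2 _ (hball hy'.2).2 h3 ?_ hne)
    rw [h2, sub_eq_zero.1 hGy']

/-- The right-hand side mentions neither a neighbourhood nor a least-squares solution map, so this
gives both independence of the choices and, in the converse direction, an admissible choice. -/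
theorem isInverseLSConditionNumber_factorProduct_iff {y₀ : FactorPair m n k}
    (hy₀ : y₀ ∈ fullRankPairs m n k) {H₀ : Matrix (Fin m) (Fin n) ℝ → FactorPair m n k}
    (hH₀ : IsLocalSolutionMap y₀ H₀) {κ : ℝ} :
    IsInverseLSConditionNumber (factorProduct m n k) (fullRankPairs m n k) y₀ κ ↔
      IsLeast {κ' | 0 ≤ κ' ∧ IsEuclideanErrorBound y₀ H₀ κ'} κ := by
  have hcongr : ∀ {V : Set (FactorPair m n k)} {U : Set (Matrix (Fin m) (Fin n) ℝ)}
      {H : Matrix (Fin m) (Fin n) ℝ → FactorPair m n k}, IsOpen V → y₀ ∈ V →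
      U ⊆ factorProduct m n k '' (fullRankPairs m n k ∩ V) →
      U ∈ 𝓝[factorProduct m n k '' (fullRankPairs m n k ∩ V)] (factorProduct m n k y₀) →
      IsLeastSquaresSolutionMap (fun x y ↦ factorProduct m n k y - x) 0 U
        (fullRankPairs m n k ∩ V) y₀ H →
      {κ' | 0 ≤ κ' ∧ IsFirstOrderErrorBound (factorProduct m n k '' (fullRankPairs m n k ∩ V)) U
        (fullRankPairs m n k ∩ V) H (factorProduct m n k y₀) κ'} =
      {κ' | 0 ≤ κ' ∧ IsEuclideanErrorBound y₀ H₀ κ'} := by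
    intro V U H hV hyV hUX hU hH
    have hW : fullRankPairs m n k ∩ V ∈ 𝓝 y₀ :=
      (isOpen_fullRankPairs.inter hV).mem_nhds ⟨hy₀, hyV⟩
    have hHH₀ := hH.eventuallyEq hy₀ hW hUX hU hH₀
    have hyW : y₀ ∈ fullRankPairs m n k ∩ V := ⟨hy₀, hyV⟩
    have hHx₀ := hH.apply_factorProduct hyW
      (mem_of_mem_nhdsWithin (mem_image_of_mem _ hyW) hU)
    have ht := (hH₀.tendsto.mono_left nhdsWithin_le_nhds).congr' hHH₀.symm
    ext κ'
    refine and_congr_right fun hκ' ↦ ?_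
    rw [isFirstOrderErrorBound_iff_isEuclideanErrorBound hy₀ hW hUX hU hHx₀ ht hκ']
    exact ⟨fun h ↦ h.congr hHH₀, fun h ↦ h.congr hHH₀.symm⟩
  constructor
  · rintro ⟨V, hV, hyV, -, -, -, -, U, H, hUX, hU, hH, hκ⟩
    rwa [IsConditionNumber, hcongr hV hyV.2 hUX hU hH] at hκ
  · intro hκ
    obtain ⟨V, hV, hyV, U, hUX, hU, hH⟩ := hH₀.exists_isLeastSquaresSolutionMap hy₀
    refine ⟨V, hV, ⟨hy₀, hyV⟩, isEmbeddedSubmanifold_image_factorProduct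
      (isOpen_fullRankPairs.inter hV) inter_subset_left, mem_image_of_mem _ ⟨hy₀, hyV⟩,
      ⟨hy₀, hyV⟩, sub_self _, U, H₀, hUX, hU, hH, ?_⟩
    rwa [IsConditionNumber, hcongr hV hyV hUX hU hH]

/-- Differentiability of `H` makes the set nonempty, and the slack `ε` in the definition makes its
infimum a member. -/
theorem IsLocalSolutionMap.exists_isLeast {y₀ : FactorPair m n k}
    {H : Matrix (Fin m) (Fin n) ℝ → FactorPair m n k} (hH : IsLocalSolutionMap y₀ H) :
    ∃ κ, IsLeast {κ' | 0 ≤ κ' ∧ IsEuclideanErrorBound y₀ H κ'} κ := by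
  set S := {κ' | 0 ≤ κ' ∧ IsEuclideanErrorBound y₀ H κ'} with hS
  have hbdd : BddBelow S := ⟨0, fun κ hκ ↦ hκ.1⟩
  have hne : S.Nonempty := by
    have hd := (hH.contDiffAt.differentiableAt (by simp)).hasFDerivAt.isBigO_sub
    obtain ⟨C, hC0, hC⟩ := hd.exists_pos
    refine ⟨C, hC0.le, fun ε hε ↦ ?_⟩
    filter_upwards [hC.bound.filter_mono nhdsWithin_le_nhds] with x hx
    rw [hH.apply_self] at hx
    refine hx.trans ?_
    gcongr
    linarith
  refine ⟨sInf S, ⟨le_csInf hne fun κ hκ ↦ hκ.1, fun ε hε ↦ ?_⟩, fun κ hκ ↦ csInf_le hbdd hκ⟩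
  obtain ⟨κ, hκ, hlt⟩ := exists_lt_of_csInf_lt hne
    (show sInf S < sInf S + ε / 2 by linarith)
  filter_upwards [hκ.2 (ε / 2) (by positivity)] with x hx
  refine hx.trans ?_
  gcongr ?_ * _
  linarith

end Reduction

/-! ### Bounds for the condition number -/

section Bounds

variable {m n k : ℕ}

/-- If `p` and `q` nearly agree, their inner product is nearly `‖p‖²`. It is applied to `p = Lᵀ a`
and `q = b Rᵀ`, which the residual equation makes equal up to second order. -/
theorem Matrix.neg_le_trace_mul_transpose {p q e : Matrix (Fin k) (Fin k) ℝ}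
    (h : p - q = e) : -(‖p‖ * ‖e‖) ≤ (p * qᵀ).trace := by
  have h1 : (p * qᵀ).trace = ‖p‖ ^ 2 - (pᵀ * e).trace := by
    rw [Matrix.frobenius_norm_sq_eq_trace, ← h, Matrix.mul_sub, Matrix.trace_sub, sub_sub_cancel,
      ← Matrix.trace_transpose, Matrix.transpose_mul, Matrix.transpose_transpose,
      Matrix.trace_mul_comm, ← Matrix.trace_transpose, Matrix.transpose_mul,
      Matrix.transpose_transpose, Matrix.trace_mul_comm, ← Matrix.trace_transpose,
      Matrix.transpose_mul, Matrix.transpose_transpose, Matrix.trace_mul_comm]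
  nlinarith [(abs_le.1 (Matrix.abs_trace_transpose_mul_le p e)).2, sq_nonneg ‖p‖]

/-- If left multiplication by `L` and right multiplication by `R` are bounded below by `τ`, then
`τ⁻¹` is a first-order error bound. -/
theorem IsLocalSolutionMap.isEuclideanErrorBound_inv {y₀ : FactorPair m n k}
    {H : Matrix (Fin m) (Fin n) ℝ → FactorPair m n k} (hH : IsLocalSolutionMap y₀ H) {τ : ℝ}
    (hτ : 0 < τ) (hL : ∀ b : Matrix (Fin k) (Fin n) ℝ, τ * ‖b‖ ≤ ‖y₀.fst * b‖)
    (hR : ∀ a : Matrix (Fin m) (Fin k) ℝ, τ * ‖a‖ ≤ ‖a * y₀.snd‖) :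
    IsEuclideanErrorBound y₀ H τ⁻¹ := by
  intro ε hε
  -- In the expansion of `((τ - c ‖d‖) ‖d‖)²`, the term `2 c τ ‖d‖³` has to outweigh `4 ‖L‖ ‖d‖³`,
  -- from the cross term, plus `c² ‖d‖⁴ ≤ ‖d‖³`.
  set c : ℝ := (4 * ‖y₀.fst‖ + 1) / τ with hc
  have hcτ : c * τ = 4 * ‖y₀.fst‖ + 1 := by rw [hc]; field_simp
  have hρ : Tendsto (fun x ↦ ‖H x - y₀‖) (𝓝 (factorProduct m n k y₀)) (𝓝 0) :=
    tendsto_iff_norm_sub_tendsto_zero.1 hH.tendsto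
  have e1 : ∀ᶠ x in 𝓝 (factorProduct m n k y₀), c ^ 2 * ‖H x - y₀‖ < 1 := by
    refine (hρ.const_mul (c ^ 2)).eventually_lt_const ?_
    simp
  have e2 : ∀ᶠ x in 𝓝 (factorProduct m n k y₀),
      1 < (τ⁻¹ + ε) * (τ - (c + 1) * ‖H x - y₀‖) := by
    refine (((hρ.const_mul (c + 1)).const_sub τ).const_mul (τ⁻¹ + ε)).eventually_const_lt ?_
    rw [mul_zero, sub_zero, add_mul, inv_mul_cancel₀ hτ.ne']
    linarith [mul_pos hε hτ]
  filter_upwards [hH.eventually_factorProduct,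
    hH.eventually_fiberResidual.filter_mono nhdsWithin_le_nhds,
    e1.filter_mono nhdsWithin_le_nhds, e2.filter_mono nhdsWithin_le_nhds] with x h1 h2 h3 h4
  set d := H x - y₀ with hd
  set a := d.fst with ha
  set b := d.snd with hb
  have hHx : H x = y₀ + d := by rw [hd, add_sub_cancel]
  have hx : x - factorProduct m n k y₀ = (y₀.fst * b + a * y₀.snd) + a * b := by
    rw [← h1, hHx]
    simp only [factorProduct, WithLp.add_fst, WithLp.add_snd, Matrix.add_mul, Matrix.mul_add]
    abel
  have hres : y₀.fstᵀ * a - b * y₀.sndᵀ = b * bᵀ - aᵀ * a := by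
    rw [fiberResidual, hHx] at h2
    simp only [WithLp.add_fst, WithLp.add_snd, add_sub_cancel_left, Matrix.transpose_add,
      Matrix.add_mul, Matrix.mul_add] at h2
    rw [sub_eq_sub_iff_add_eq_add, add_comm (b * bᵀ)]
    exact sub_eq_zero.1 h2
  have had : ‖a‖ ≤ ‖d‖ := WithLp.norm_fst_le _ _
  have hbd : ‖b‖ ≤ ‖d‖ := WithLp.norm_snd_le _ _
  have hdsq : ‖d‖ ^ 2 = ‖a‖ ^ 2 + ‖b‖ ^ 2 := WithLp.prod_norm_sq_eq_of_L2 _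
  have hab : ‖a * b‖ ≤ ‖d‖ ^ 2 := by
    rw [sq]
    exact (Matrix.frobenius_norm_mul _ _).trans
      (mul_le_mul had hbd (norm_nonneg _) (norm_nonneg _))
  have he : ‖b * bᵀ - aᵀ * a‖ ≤ 2 * ‖d‖ ^ 2 := by
    have e1 := Matrix.frobenius_norm_mul b bᵀ
    have e2 := Matrix.frobenius_norm_mul aᵀ a
    rw [Matrix.frobenius_norm_transpose] at e1 e2
    have e3 := norm_sub_le (b * bᵀ) (aᵀ * a)
    nlinarith [sq_nonneg ‖a‖, sq_nonneg ‖b‖]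
  have hp : ‖y₀.fstᵀ * a‖ ≤ ‖y₀.fst‖ * ‖d‖ := by
    refine (Matrix.frobenius_norm_mul _ _).trans ?_
    rw [Matrix.frobenius_norm_transpose]
    gcongr
  -- The inner product of `L b` and `a R` equals that of `Lᵀ a` and `b Rᵀ`, hence is nonnegative up
  -- to third order in `d`.
  have hcross : -(2 * ‖y₀.fst‖ * ‖d‖ ^ 3) ≤ ((y₀.fst * b)ᵀ * (a * y₀.snd)).trace := by
    have e1 : ((y₀.fst * b)ᵀ * (a * y₀.snd)).trace =
        ((y₀.fstᵀ * a) * (b * y₀.sndᵀ)ᵀ).trace := by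
      rw [Matrix.transpose_mul, Matrix.mul_assoc, Matrix.trace_mul_comm, Matrix.transpose_mul,
        Matrix.transpose_transpose]
      simp only [Matrix.mul_assoc]
    rw [e1]
    refine le_trans ?_ (Matrix.neg_le_trace_mul_transpose hres)
    have e2 : ‖y₀.fstᵀ * a‖ * ‖b * bᵀ - aᵀ * a‖ ≤ ‖y₀.fst‖ * ‖d‖ * (2 * ‖d‖ ^ 2) :=
      mul_le_mul hp he (norm_nonneg _) (by positivity)
    nlinarith
  have hN : (τ - c * ‖d‖) * ‖d‖ ≤ ‖y₀.fst * b + a * y₀.snd‖ := by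
    refine le_of_sq_le_sq ?_ (norm_nonneg _)
    rw [Matrix.frobenius_norm_add_sq]
    have f1 : τ ^ 2 * ‖b‖ ^ 2 ≤ ‖y₀.fst * b‖ ^ 2 := by
      rw [← mul_pow]; gcongr; exact hL b
    have f2 : τ ^ 2 * ‖a‖ ^ 2 ≤ ‖a * y₀.snd‖ ^ 2 := by
      rw [← mul_pow]; gcongr; exact hR a
    have f3 : c ^ 2 * ‖d‖ * ‖d‖ ^ 3 ≤ 1 * ‖d‖ ^ 3 := by gcongr
    have f4 : ((τ - c * ‖d‖) * ‖d‖) ^ 2 =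
        τ ^ 2 * ‖d‖ ^ 2 - 2 * (c * τ) * ‖d‖ ^ 3 + c ^ 2 * ‖d‖ * ‖d‖ ^ 3 := by ring
    have f5 : 0 ≤ ‖y₀.fst‖ * ‖d‖ ^ 3 := by positivity
    have f6 : 0 ≤ ‖d‖ ^ 3 := by positivity
    rw [f4, hcτ, hdsq]
    nlinarith
  have hfin : (τ - (c + 1) * ‖d‖) * ‖d‖ ≤ ‖x - factorProduct m n k y₀‖ := by
    have g1 := norm_sub_le_norm_add (y₀.fst * b + a * y₀.snd) (a * b)
    rw [hx]
    nlinarith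
  calc ‖d‖ = 1 * ‖d‖ := (one_mul _).symm
    _ ≤ (τ⁻¹ + ε) * (τ - (c + 1) * ‖d‖) * ‖d‖ := by gcongr
    _ = (τ⁻¹ + ε) * ((τ - (c + 1) * ‖d‖) * ‖d‖) := by ring
    _ ≤ _ := by gcongr

theorem Matrix.exists_mul_eq_zero_of_lt (hkm : k < m) (L : Matrix (Fin m) (Fin k) ℝ) :
    ∃ w : Matrix (Fin 1) (Fin m) ℝ, w * L = 0 ∧ w * wᵀ = 1 := by
  obtain ⟨v, hv, hv0⟩ := Submodule.exists_mem_ne_zero_of_ne_bot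
    (LinearMap.ker_ne_bot_of_finrank_lt (f := Lᵀ.mulVecLin) (by simpa using hkm))
  have hvv : 0 < v ⬝ᵥ v := by
    refine lt_of_le_of_ne ?_ fun h ↦ hv0 (dotProduct_self_eq_zero.1 h.symm)
    exact Finset.sum_nonneg fun i _ ↦ mul_self_nonneg _
  refine ⟨(√(v ⬝ᵥ v))⁻¹ • Matrix.of fun _ ↦ v, ?_, ?_⟩
  · rw [Matrix.smul_mul]
    convert smul_zero _
    ext i j
    have h1 : (Lᵀ *ᵥ v) j = 0 := congrFun hv j
    rw [Matrix.mulVec_transpose] at h1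
    exact h1
  · ext i j
    have h1 : √(v ⬝ᵥ v) * √(v ⬝ᵥ v) = v ⬝ᵥ v := Real.mul_self_sqrt hvv.le
    have h2 : ((Matrix.of fun _ ↦ v : Matrix (Fin 1) (Fin m) ℝ) *
        (Matrix.of fun _ ↦ v : Matrix (Fin 1) (Fin m) ℝ)ᵀ) i j = v ⬝ᵥ v := by
      simp [Matrix.mul_apply, dotProduct]
    rw [Matrix.transpose_smul, Matrix.smul_mul, Matrix.mul_smul, Matrix.smul_apply,
      Matrix.smul_apply, h2, Subsingleton.elim i j, Matrix.one_apply_eq, smul_eq_mul, smul_eq_mul,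
      ← mul_assoc, ← mul_inv, h1, inv_mul_cancel₀ hvv.ne']

/-- First `t` and then `ε` tends to zero from the right. -/
theorem le_mul_of_forall_eventually {κ V N q : ℝ}
    (h : ∀ ε > 0, ∀ᶠ t in 𝓝[>] (0 : ℝ), V ≤ (κ + ε) * N * (1 + (κ + ε) * (t * N) * q)) :
    V ≤ κ * N := by
  have h1 : ∀ ε > 0, V ≤ (κ + ε) * N := fun ε hε ↦ by
    have hc : Continuous fun t : ℝ ↦ (κ + ε) * N * (1 + (κ + ε) * (t * N) * q) := by fun_prop
    have ht := (hc.tendsto 0).mono_left (nhdsWithin_le_nhds (s := Ioi 0))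
    simpa using ge_of_tendsto ht (h ε hε)
  have hc : Continuous fun ε : ℝ ↦ (κ + ε) * N := by fun_prop
  have ht := (hc.tendsto 0).mono_left (nhdsWithin_le_nhds (s := Ioi 0))
  simpa using ge_of_tendsto ht (eventually_mem_nhdsWithin.mono h1)

/-- A first-order error bound, applied to a curve of products whose direction is `z`. -/
theorem IsEuclideanErrorBound.eventually_line {y₀ : FactorPair m n k}
    {H : Matrix (Fin m) (Fin n) ℝ → FactorPair m n k} {κ : ℝ} (h : IsEuclideanErrorBound y₀ H κ)
    (hH : IsLocalSolutionMap y₀ H) {z : Matrix (Fin m) (Fin n) ℝ}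
    (hz : ∀ t : ℝ, factorProduct m n k y₀ + t • z ∈ range (factorProduct m n k)) {ε : ℝ}
    (hε : 0 < ε) :
    ∀ᶠ t in 𝓝[>] (0 : ℝ), 0 < t ∧ ∃ d : FactorPair m n k, ‖d‖ ≤ (κ + ε) * (t * ‖z‖) ∧
      y₀.fst * d.snd + d.fst * y₀.snd + d.fst * d.snd = t • z := by
  have hc : Continuous fun t : ℝ ↦ factorProduct m n k y₀ + t • z := by fun_prop
  have ht : Tendsto (fun t : ℝ ↦ factorProduct m n k y₀ + t • z) (𝓝[>] 0)
      (𝓝[range (factorProduct m n k)] (factorProduct m n k y₀)) := by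
    refine tendsto_nhdsWithin_iff.2 ⟨?_, Eventually.of_forall hz⟩
    have := (hc.tendsto 0).mono_left (nhdsWithin_le_nhds (s := Ioi 0))
    rwa [zero_smul, add_zero] at this
  filter_upwards [ht (h ε hε), ht hH.eventually_factorProduct, eventually_mem_nhdsWithin]
    with t h1 h2 h3
  set x := factorProduct m n k y₀ + t • z with hx
  refine ⟨h3, H x - y₀, ?_, ?_⟩
  · have h1' : ‖H x - y₀‖ ≤ (κ + ε) * ‖x - factorProduct m n k y₀‖ := h1
    rwa [hx, add_sub_cancel_left, norm_smul, Real.norm_of_nonneg (le_of_lt h3)] at h1'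
  · have h2' : factorProduct m n k (H x) = x := h2
    have e : t • z = factorProduct m n k (H x) - factorProduct m n k y₀ := by
      rw [h2', hx, add_sub_cancel_left]
    rw [e]
    simp only [factorProduct, WithLp.sub_fst, WithLp.sub_snd, Matrix.sub_mul, Matrix.mul_sub]
    abel

theorem Matrix.frobenius_norm_eq_one_of_mul_transpose {w : Matrix (Fin 1) (Fin m) ℝ}
    (hw : w * wᵀ = 1) : ‖w‖ = 1 := by
  have h : ‖wᵀ‖ ^ 2 = 1 := by
    rw [Matrix.frobenius_norm_sq_eq_trace, Matrix.transpose_transpose, hw]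
    simp
  rw [Matrix.frobenius_norm_transpose] at h
  exact (pow_eq_one_iff_of_nonneg (norm_nonneg _) two_ne_zero).1 h

/-- Choose a unit row `w` with `w L = 0`, possible as `k < m`, and perturb the product by `t wᵀ v
R`, which amounts to moving `L` alone. Multiplying `L b + a R + a b = t wᵀ v R` by `w` and `Q`
leaves `w a = t v` up to second order, so every solution moves by about `t ‖v‖` at least, while the
bound allows about `κ t ‖v R‖`. -/
theorem IsEuclideanErrorBound.norm_le_mul_norm_mul_snd {y₀ : FactorPair m n k}
    (hy₀ : y₀ ∈ fullRankPairs m n k)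
    {H : Matrix (Fin m) (Fin n) ℝ → FactorPair m n k} {κ : ℝ} (hκ : 0 ≤ κ)
    (h : IsEuclideanErrorBound y₀ H κ) (hH : IsLocalSolutionMap y₀ H) (hkm : k < m)
    (v : Matrix (Fin 1) (Fin k) ℝ) : ‖v‖ ≤ κ * ‖v * y₀.snd‖ := by
  obtain ⟨Q, hQ⟩ := Matrix.exists_right_inverse_of_rank_eq hy₀.2
  obtain ⟨w, hwL, hw⟩ := Matrix.exists_mul_eq_zero_of_lt hkm y₀.fst
  have hw1 := Matrix.frobenius_norm_eq_one_of_mul_transpose hw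
  refine le_mul_of_forall_eventually (q := ‖Q‖) fun ε hε ↦ ?_
  have hz : ∀ t : ℝ, factorProduct m n k y₀ + t • (wᵀ * (v * y₀.snd)) ∈
      range (factorProduct m n k) := fun t ↦
    ⟨WithLp.toLp 2 (y₀.fst + t • (wᵀ * v), y₀.snd), by
      simp [factorProduct, Matrix.add_mul, Matrix.mul_assoc]⟩
  filter_upwards [h.eventually_line hH hz hε] with t ⟨ht, d, hd, hdz⟩
  have hzn : ‖wᵀ * (v * y₀.snd)‖ ≤ ‖v * y₀.snd‖ := by
    refine (Matrix.frobenius_norm_mul _ _).trans_eq ?_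
    rw [Matrix.frobenius_norm_transpose, hw1, one_mul]
  have hd' : ‖d‖ ≤ (κ + ε) * (t * ‖v * y₀.snd‖) := hd.trans (by gcongr)
  have key : t • v = w * d.fst + w * d.fst * d.snd * Q := by
    have h1 := congrArg (fun M ↦ w * M * Q) hdz
    simp only [Matrix.mul_add, Matrix.add_mul, Matrix.mul_smul, Matrix.smul_mul] at h1
    rw [← Matrix.mul_assoc w y₀.fst, hwL, ← Matrix.mul_assoc w wᵀ, hw, Matrix.one_mul,
      Matrix.zero_mul, Matrix.zero_mul, zero_add, Matrix.mul_assoc v, hQ, Matrix.mul_one,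
      ← Matrix.mul_assoc, Matrix.mul_assoc _ y₀.snd, hQ, Matrix.mul_one, ← Matrix.mul_assoc] at h1
    exact h1.symm
  have n1 : ‖w * d.fst‖ ≤ ‖d‖ := by
    refine (Matrix.frobenius_norm_mul _ _).trans ?_
    rw [hw1, one_mul]
    exact WithLp.norm_fst_le _ _
  have n2 : ‖w * d.fst * d.snd * Q‖ ≤ ‖d‖ * ‖d‖ * ‖Q‖ := by
    refine (Matrix.frobenius_norm_mul _ _).trans ?_
    gcongr
    refine (Matrix.frobenius_norm_mul _ _).trans ?_
    gcongr
    exact WithLp.norm_snd_le _ _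
  have n3 : t * ‖v‖ ≤ ‖d‖ * (1 + ‖d‖ * ‖Q‖) := by
    rw [← Real.norm_of_nonneg ht.le, ← norm_smul, key]
    refine (norm_add_le _ _).trans ?_
    linarith
  refine le_of_mul_le_mul_left ?_ ht
  calc t * ‖v‖ ≤ ‖d‖ * (1 + ‖d‖ * ‖Q‖) := n3
    _ ≤ (κ + ε) * (t * ‖v * y₀.snd‖) * (1 + (κ + ε) * (t * ‖v * y₀.snd‖) * ‖Q‖) := by gcongr
    _ = _ := by ring

/-- The mirror image: `R` alone is perturbed, along a unit row `w` with `R wᵀ = 0`, which exists as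
`k < n`. -/
theorem IsEuclideanErrorBound.norm_le_mul_norm_fst_mul {y₀ : FactorPair m n k}
    (hy₀ : y₀ ∈ fullRankPairs m n k)
    {H : Matrix (Fin m) (Fin n) ℝ → FactorPair m n k} {κ : ℝ} (hκ : 0 ≤ κ)
    (h : IsEuclideanErrorBound y₀ H κ) (hH : IsLocalSolutionMap y₀ H) (hkn : k < n)
    (v : Matrix (Fin k) (Fin 1) ℝ) : ‖v‖ ≤ κ * ‖y₀.fst * v‖ := by
  obtain ⟨P, hP⟩ := Matrix.exists_left_inverse_of_rank_eq hy₀.1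
  obtain ⟨w, hwR, hw⟩ := Matrix.exists_mul_eq_zero_of_lt hkn y₀.sndᵀ
  replace hwR : y₀.snd * wᵀ = 0 := by
    rw [← Matrix.transpose_transpose y₀.snd, ← Matrix.transpose_mul, hwR, Matrix.transpose_zero]
  have hw1 := Matrix.frobenius_norm_eq_one_of_mul_transpose hw
  refine le_mul_of_forall_eventually (q := ‖P‖) fun ε hε ↦ ?_
  have hz : ∀ t : ℝ, factorProduct m n k y₀ + t • (y₀.fst * v * w) ∈
      range (factorProduct m n k) := fun t ↦
    ⟨WithLp.toLp 2 (y₀.fst, y₀.snd + t • (v * w)), by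
      simp [factorProduct, Matrix.mul_add, Matrix.mul_assoc]⟩
  filter_upwards [h.eventually_line hH hz hε] with t ⟨ht, d, hd, hdz⟩
  have hzn : ‖y₀.fst * v * w‖ ≤ ‖y₀.fst * v‖ := by
    refine (Matrix.frobenius_norm_mul _ _).trans_eq ?_
    rw [hw1, mul_one]
  have hd' : ‖d‖ ≤ (κ + ε) * (t * ‖y₀.fst * v‖) := hd.trans (by gcongr)
  have key : t • v = d.snd * wᵀ + P * (d.fst * (d.snd * wᵀ)) := by
    have h1 := congrArg (fun M ↦ P * (M * wᵀ)) hdz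
    simp only [Matrix.mul_add, Matrix.add_mul, Matrix.mul_smul, Matrix.smul_mul,
      Matrix.mul_assoc] at h1
    rw [hwR, hw, Matrix.mul_zero, Matrix.mul_zero, add_zero, Matrix.mul_one, ← Matrix.mul_assoc,
      hP, Matrix.one_mul, ← Matrix.mul_assoc P y₀.fst v, hP, Matrix.one_mul] at h1
    exact h1.symm
  have n1 : ‖d.snd * wᵀ‖ ≤ ‖d‖ := by
    refine (Matrix.frobenius_norm_mul _ _).trans ?_
    rw [Matrix.frobenius_norm_transpose, hw1, mul_one]
    exact WithLp.norm_snd_le _ _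
  have n2 : ‖P * (d.fst * (d.snd * wᵀ))‖ ≤ ‖P‖ * (‖d‖ * ‖d‖) := by
    refine (Matrix.frobenius_norm_mul _ _).trans ?_
    gcongr
    refine (Matrix.frobenius_norm_mul _ _).trans ?_
    gcongr
    exact WithLp.norm_fst_le _ _
  have n3 : t * ‖v‖ ≤ ‖d‖ * (1 + ‖d‖ * ‖P‖) := by
    rw [← Real.norm_of_nonneg ht.le, ← norm_smul, key]
    refine (norm_add_le _ _).trans ?_
    linarith
  refine le_of_mul_le_mul_left ?_ ht
  calc t * ‖v‖ ≤ ‖d‖ * (1 + ‖d‖ * ‖P‖) := n3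
    _ ≤ (κ + ε) * (t * ‖y₀.fst * v‖) * (1 + (κ + ε) * (t * ‖y₀.fst * v‖) * ‖P‖) := by gcongr
    _ = _ := by ring

end Bounds

/-! ### Singular values -/

section SingularValues

variable {m n k : ℕ}

theorem finrank_range_toEuclideanLin (X : Matrix (Fin m) (Fin n) ℝ) :
    Module.finrank ℝ (LinearMap.range (Matrix.toEuclideanLin X)) = X.rank := by
  change Module.finrank ℝ (LinearMap.range (Matrix.toLpLin 2 2 X)) = X.rank
  rw [Matrix.toLpLin_eq_toLin]
  exact (Matrix.rank_eq_finrank_range_toLin X _ _).symm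

theorem adjoint_comp_self_toEuclideanLin (X : Matrix (Fin m) (Fin n) ℝ)
    (v : EuclideanSpace ℝ (Fin n)) :
    (LinearMap.adjoint (Matrix.toEuclideanLin X) ∘ₗ Matrix.toEuclideanLin X) v =
      WithLp.toLp 2 ((Xᵀ * X) *ᵥ v.ofLp) := by
  rw [← Matrix.toEuclideanLin_conjTranspose_eq_adjoint, LinearMap.comp_apply,
    Matrix.toLpLin_apply, Matrix.toLpLin_apply, Matrix.mulVec_mulVec,
    Matrix.conjTranspose_eq_transpose_of_trivial]

/-- The right singular vectors of a matrix. -/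
theorem exists_orthonormalBasis_mulVec_eq (X : Matrix (Fin m) (Fin n) ℝ) :
    ∃ b : OrthonormalBasis (Fin n) ℝ (EuclideanSpace ℝ (Fin n)), ∀ i,
      (Xᵀ * X) *ᵥ (b i).ofLp = (Matrix.toEuclideanLin X).singularValues i ^ 2 • (b i).ofLp := by
  set T := Matrix.toEuclideanLin X with hT
  have hn : Module.finrank ℝ (EuclideanSpace ℝ (Fin n)) = n := finrank_euclideanSpace_fin
  refine ⟨T.isSymmetric_adjoint_comp_self.eigenvectorBasis hn, fun i ↦ ?_⟩
  have h := T.isSymmetric_adjoint_comp_self.apply_eigenvectorBasis hn i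
  rw [adjoint_comp_self_toEuclideanLin, ← T.sq_singularValues_fin hn] at h
  exact congrArg WithLp.ofLp h

theorem sigma_pos {X : Matrix (Fin m) (Fin n) ℝ} (hk : 1 ≤ k) (hX : X.rank = k) :
    0 < sigma k X := by
  rw [sigma, LinearMap.singularValues_pos_iff_lt_finrank_range, finrank_range_toEuclideanLin]
  omega

/-- A right singular vector for the smallest nonzero singular value. -/
theorem exists_mul_eq_sigma_sq_smul {X : Matrix (Fin m) (Fin n) ℝ} (hk : 1 ≤ k) (hkn : k < n) :
    ∃ z : Matrix (Fin n) (Fin 1) ℝ, z ≠ 0 ∧ Xᵀ * X * z = sigma k X ^ 2 • z := by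
  obtain ⟨b, hb⟩ := exists_orthonormalBasis_mulVec_eq X
  -- `singularValues` is indexed from zero, so the `k`-th largest has index `k - 1`.
  set i : Fin n := ⟨k - 1, by omega⟩ with hi
  refine ⟨Matrix.of fun a _ ↦ b i a, fun h ↦ b.orthonormal.ne_zero i ?_, ?_⟩
  · ext a
    exact congrFun (congrFun h a) 0
  · ext a j
    exact congrFun (hb i) a

/-- `s i ^ 2` is an eigenvalue of `Xᵀ X`, so `s i` is a positive singular value and hence one of the
`k` largest. -/
theorem sigma_le_of_isCompactSVD {X : Matrix (Fin m) (Fin n) ℝ} (hX : X.rank = k)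
    {U : Matrix (Fin m) (Fin k) ℝ} {s : Fin k → ℝ} {V : Matrix (Fin n) (Fin k) ℝ}
    (h : IsCompactSVD X U s V) (i : Fin k) : sigma k X ≤ s i := by
  obtain ⟨hU, hV, hs, hXe⟩ := h
  set T := Matrix.toEuclideanLin X with hT
  have hn : Module.finrank ℝ (EuclideanSpace ℝ (Fin n)) = n := finrank_euclideanSpace_fin
  have hXV : Xᵀ * X * V = V * Matrix.diagonal (fun i ↦ s i ^ 2) := by
    calc Xᵀ * X * V = V * Matrix.diagonal s * (Uᵀ * U) * Matrix.diagonal s * (Vᵀ * V) := by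
          rw [hXe]
          simp only [Matrix.transpose_mul, Matrix.transpose_transpose, Matrix.diagonal_transpose,
            Matrix.mul_assoc]
      _ = V * Matrix.diagonal (fun i ↦ s i ^ 2) := by
          rw [hU, hV, Matrix.mul_one, Matrix.mul_one, Matrix.mul_assoc, Matrix.diagonal_mul_diagonal]
          simp only [sq]
  have hev : Module.End.HasEigenvalue (LinearMap.adjoint T ∘ₗ T) (s i ^ 2) := by
    refine Module.End.hasEigenvalue_of_hasEigenvector
      (x := WithLp.toLp 2 (fun a ↦ V a i)) ⟨Module.End.mem_eigenspace_iff.2 ?_, fun h0 ↦ ?_⟩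
    · rw [adjoint_comp_self_toEuclideanLin]
      ext a
      have h1 := congrFun (congrFun hXV a) i
      rw [Matrix.mul_diagonal] at h1
      simp only [PiLp.smul_apply, smul_eq_mul]
      rw [mul_comm, ← h1]
      rfl
    · have h1 := congrFun (congrFun hV i) i
      have h2 : ∀ a, V a i = 0 := fun a ↦ congrFun (congrArg WithLp.ofLp h0) a
      simp [Matrix.mul_apply, h2] at h1
  obtain ⟨j, hj⟩ := T.isSymmetric_adjoint_comp_self.exists_eigenvalues_eq hn hev
  rw [← T.sq_singularValues_fin hn] at hj
  have hj' : T.singularValues j = s i :=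
    (pow_left_inj₀ (T.singularValues_nonneg _) (hs i).le two_ne_zero).1 hj
  have hjk : (j : ℕ) < k := by
    rw [← hX, ← finrank_range_toEuclideanLin, ← T.singularValues_pos_iff_lt_finrank_range, hj']
    exact hs i
  rw [← hj']
  exact T.singularValues_antitone (by omega)

/-- `V` consists of the first `k` right singular vectors, and `U = X V Σ⁻¹`. -/
theorem exists_isCompactSVD {X : Matrix (Fin m) (Fin n) ℝ} (hkn : k ≤ n) (hX : X.rank = k) :
    ∃ (U : Matrix (Fin m) (Fin k) ℝ) (s : Fin k → ℝ) (V : Matrix (Fin n) (Fin k) ℝ),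
      IsCompactSVD X U s V := by
  obtain ⟨b, hb⟩ := exists_orthonormalBasis_mulVec_eq X
  set T := Matrix.toEuclideanLin X with hT
  have hdot : ∀ i j, ∑ a, b i a * b j a = if i = j then 1 else 0 := fun i j ↦ by
    have := orthonormal_iff_ite.1 b.orthonormal i j
    rw [PiLp.inner_apply] at this
    simpa [mul_comm] using this
  let V : Matrix (Fin n) (Fin k) ℝ := Matrix.of fun a i ↦ b (Fin.castLE hkn i) a
  let s : Fin k → ℝ := fun i ↦ T.singularValues i
  have hs : ∀ i, 0 < s i := fun i ↦ by
    rw [T.singularValues_pos_iff_lt_finrank_range, finrank_range_toEuclideanLin, hX]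
    exact i.2
  have hV : Vᵀ * V = 1 := by
    ext i j
    rw [Matrix.mul_apply, Matrix.one_apply]
    simpa [V] using hdot (Fin.castLE hkn i) (Fin.castLE hkn j)
  have hXV : Xᵀ * X * V = V * Matrix.diagonal (fun i ↦ s i ^ 2) := by
    ext a i
    rw [Matrix.mul_diagonal, mul_comm]
    exact congrFun (hb (Fin.castLE hkn i)) a
  -- Checked on the eigenbasis: `V Vᵀ` fixes the first `k` vectors, and both `Vᵀ` and `X` annihilate
  -- the others.
  have hXVV : X * V * Vᵀ = X := by
    refine Matrix.toEuclideanLin.injective (b.toBasis.ext fun i ↦ ?_)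
    rw [b.coe_toBasis, Matrix.toLpLin_apply, Matrix.toLpLin_apply]
    congr 1
    rcases lt_or_ge (i : ℕ) k with hi | hi
    · have h1 : Vᵀ *ᵥ (b i).ofLp = Pi.single (⟨i, hi⟩ : Fin k) 1 := by
        ext j
        have := hdot (Fin.castLE hkn j) i
        simp only [Matrix.mulVec, dotProduct, V, Matrix.transpose_apply, Matrix.of_apply]
        rw [this, Pi.single_apply]
        simp [Fin.ext_iff]
      rw [Matrix.mul_assoc, ← Matrix.mulVec_mulVec, ← Matrix.mulVec_mulVec, h1,
        Matrix.mulVec_single_one]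
      rfl
    · have h1 : Vᵀ *ᵥ (b i).ofLp = 0 := by
        ext j
        have := hdot (Fin.castLE hkn j) i
        simp only [Matrix.mulVec, dotProduct, V, Matrix.transpose_apply, Matrix.of_apply]
        rw [this, if_neg]
        · rfl
        · intro h
          have := congrArg Fin.val h
          simp at this
          omega
      have h2 : T.singularValues i = 0 := by
        rw [T.singularValues_eq_zero_iff_le_finrank_range, finrank_range_toEuclideanLin, hX]
        exact hi
      have h3 := hb i
      rw [h2, zero_pow two_ne_zero, zero_smul, ← Matrix.mulVec_mulVec] at h3
      have h4 : X *ᵥ (b i).ofLp = 0 := by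
        rw [← dotProduct_self_eq_zero, Matrix.dotProduct_mulVec, ← Matrix.mulVec_transpose, h3,
          zero_dotProduct]
      rw [h4, ← Matrix.mulVec_mulVec, h1, Matrix.mulVec_zero]
  have hdiag : Matrix.diagonal (fun i ↦ (s i)⁻¹) * Matrix.diagonal s = 1 := by
    rw [Matrix.diagonal_mul_diagonal, ← Matrix.diagonal_one]
    congr 1
    exact funext fun i ↦ inv_mul_cancel₀ (hs i).ne'
  refine ⟨X * V * Matrix.diagonal (fun i ↦ (s i)⁻¹), s, V, ?_, hV, hs, ?_⟩
  · calc (X * V * Matrix.diagonal fun i ↦ (s i)⁻¹)ᵀ * (X * V * Matrix.diagonal fun i ↦ (s i)⁻¹)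
        = (Matrix.diagonal fun i ↦ (s i)⁻¹) * (Vᵀ * (Xᵀ * X * V)) *
            Matrix.diagonal fun i ↦ (s i)⁻¹ := by
          simp only [Matrix.transpose_mul, Matrix.diagonal_transpose, Matrix.mul_assoc]
      _ = 1 := by
          rw [hXV, ← Matrix.mul_assoc Vᵀ, hV, Matrix.one_mul, Matrix.diagonal_mul_diagonal,
            Matrix.diagonal_mul_diagonal, ← Matrix.diagonal_one]
          congr 1
          funext i
          have := (hs i).ne'
          field_simp
  · rw [Matrix.mul_assoc (X * V), hdiag, Matrix.mul_one, hXVV]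

end SingularValues

/-! ### The main theorem -/

section Main

variable {m n k : ℕ}

theorem Matrix.frobenius_norm_mul_of_transpose_mul_self {p : ℕ} {U : Matrix (Fin m) (Fin k) ℝ}
    (hU : Uᵀ * U = 1) (M : Matrix (Fin k) (Fin p) ℝ) : ‖U * M‖ = ‖M‖ := by
  rw [← pow_left_inj₀ (norm_nonneg _) (norm_nonneg _) two_ne_zero,
    Matrix.frobenius_norm_sq_eq_trace, Matrix.frobenius_norm_sq_eq_trace, Matrix.transpose_mul,
    Matrix.mul_assoc, ← Matrix.mul_assoc Uᵀ, hU, Matrix.one_mul]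

theorem Matrix.mul_norm_le_norm_diagonal_mul {p : ℕ} {τ : ℝ} (hτ : 0 ≤ τ) {d : Fin k → ℝ}
    (hd : ∀ i, τ ≤ d i) (M : Matrix (Fin k) (Fin p) ℝ) : τ * ‖M‖ ≤ ‖Matrix.diagonal d * M‖ := by
  refine le_of_sq_le_sq ?_ (norm_nonneg _)
  rw [mul_pow, Matrix.frobenius_norm_sq, Matrix.frobenius_norm_sq, Finset.mul_sum]
  refine Finset.sum_le_sum fun i _ ↦ ?_
  rw [Finset.mul_sum]
  refine Finset.sum_le_sum fun j _ ↦ ?_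
  rw [Matrix.diagonal_mul, mul_pow]
  have := hd i
  gcongr

/-- For a right singular vector `z` at `σ = σ_k(X)`, the two one-sided bounds chain to `‖z‖ ≤ κ ‖R
z‖ ≤ κ² ‖X z‖ = κ² σ ‖z‖`. -/
theorem inv_sqrt_sigma_le_of_isEuclideanErrorBound (hk : 1 ≤ k) (hkm : k < m) (hkn : k < n)
    {y₀ : FactorPair m n k} (hy₀ : y₀ ∈ fullRankPairs m n k)
    (hX : (factorProduct m n k y₀).rank = k)
    {H : Matrix (Fin m) (Fin n) ℝ → FactorPair m n k} (hH : IsLocalSolutionMap y₀ H) {κ : ℝ}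
    (hκ : 0 ≤ κ) (h : IsEuclideanErrorBound y₀ H κ) :
    (√(sigma k (factorProduct m n k y₀)))⁻¹ ≤ κ := by
  set X := factorProduct m n k y₀ with hXdef
  set σ := sigma k X with hσdef
  have hσ : 0 < σ := sigma_pos hk hX
  obtain ⟨z, hz0, hz⟩ := exists_mul_eq_sigma_sq_smul (X := X) hk hkn
  rw [← hσdef] at hz
  have hznorm : 0 < ‖z‖ := norm_pos_iff.2 hz0
  -- From `Xᵀ X z = σ² z` and `Xᵀ = Rᵀ Lᵀ` this `q` satisfies `Rᵀ q = z`. The bound for rows `v R`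
  -- then transfers to `R z` by pairing `q` with `R z`.
  set q : Matrix (Fin k) (Fin 1) ℝ := (σ ^ 2)⁻¹ • (y₀.fstᵀ * (X * z)) with hq
  have hqz : y₀.sndᵀ * q = z := by
    rw [hq, Matrix.mul_smul, ← Matrix.mul_assoc, ← Matrix.transpose_mul, ← factorProduct, ← hXdef,
      ← Matrix.mul_assoc, hz, inv_smul_smul₀ (by positivity)]
  have hq1 : ‖q‖ ≤ κ * ‖z‖ := by
    have := h.norm_le_mul_norm_mul_snd hy₀ hκ hH hkm qᵀ
    rwa [← Matrix.frobenius_norm_transpose (qᵀ * y₀.snd), Matrix.transpose_mul,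
      Matrix.transpose_transpose, hqz, Matrix.frobenius_norm_transpose] at this
  have hz1 : ‖z‖ ≤ κ * ‖y₀.snd * z‖ := by
    have e : ‖z‖ ^ 2 = (qᵀ * (y₀.snd * z)).trace := by
      rw [Matrix.frobenius_norm_sq_eq_trace]
      nth_rewrite 1 [← hqz]
      rw [Matrix.transpose_mul, Matrix.transpose_transpose, Matrix.mul_assoc]
    have e1 := (le_abs_self _).trans (Matrix.abs_trace_transpose_mul_le q (y₀.snd * z))
    rw [← e] at e1
    have e2 : ‖q‖ * ‖y₀.snd * z‖ ≤ κ * ‖z‖ * ‖y₀.snd * z‖ := by gcongr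
    refine le_of_mul_le_mul_left ?_ hznorm
    linarith
  have hz2 : ‖y₀.snd * z‖ ≤ κ * ‖X * z‖ := by
    have := h.norm_le_mul_norm_fst_mul hy₀ hκ hH hkn (y₀.snd * z)
    rwa [← Matrix.mul_assoc] at this
  have hz3 : ‖X * z‖ = σ * ‖z‖ := by
    rw [← pow_left_inj₀ (norm_nonneg _) (by positivity) two_ne_zero, mul_pow,
      Matrix.frobenius_norm_sq_eq_trace, Matrix.frobenius_norm_sq_eq_trace, Matrix.transpose_mul,
      Matrix.mul_assoc, ← Matrix.mul_assoc Xᵀ, hz, Matrix.mul_smul, Matrix.trace_smul, smul_eq_mul]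
  have hfin : 1 ≤ κ ^ 2 * σ := by
    refine le_of_mul_le_mul_right ?_ hznorm
    calc 1 * ‖z‖ = ‖z‖ := one_mul _
      _ ≤ κ * ‖y₀.snd * z‖ := hz1
      _ ≤ κ * (κ * (σ * ‖z‖)) := by rw [← hz3]; gcongr
      _ = _ := by ring
  have hs : 0 < √σ := Real.sqrt_pos.2 hσ
  rw [inv_le_iff_one_le_mul₀ hs]
  refine le_of_sq_le_sq ?_ (by positivity)
  rwa [one_pow, mul_pow, Real.sq_sqrt hσ.le]

theorem IsCompactSVD.rank_mul_diagonal_sqrt {X : Matrix (Fin m) (Fin n) ℝ}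
    {U : Matrix (Fin m) (Fin k) ℝ} {s : Fin k → ℝ} {V : Matrix (Fin n) (Fin k) ℝ}
    (h : IsCompactSVD X U s V) :
    (U * Matrix.diagonal (fun i ↦ √(s i))).rank = k ∧
      (Matrix.diagonal (fun i ↦ √(s i)) * Vᵀ).rank = k := by
  obtain ⟨hU, hV, hs, -⟩ := h
  have hdet : IsUnit (Matrix.diagonal (fun i ↦ √(s i))).det := by
    rw [Matrix.det_diagonal, isUnit_iff_ne_zero]
    exact Finset.prod_ne_zero_iff.2 fun i _ ↦ (Real.sqrt_pos.2 (hs i)).ne'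
  constructor
  · refine Matrix.rank_eq_of_isUnit_det_mul (P := Uᵀ) ?_
    rwa [← Matrix.mul_assoc, hU, Matrix.one_mul]
  · refine Matrix.rank_eq_of_isUnit_det_mul' (Q := V) ?_
    rwa [Matrix.mul_assoc, hV, Matrix.mul_one]

theorem IsCompactSVD.mul_eq {X : Matrix (Fin m) (Fin n) ℝ}
    {U : Matrix (Fin m) (Fin k) ℝ} {s : Fin k → ℝ} {V : Matrix (Fin n) (Fin k) ℝ}
    (h : IsCompactSVD X U s V) :
    (U * Matrix.diagonal (fun i ↦ √(s i))) * (Matrix.diagonal (fun i ↦ √(s i)) * Vᵀ) = X := by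
  obtain ⟨-, -, hs, hX⟩ := h
  rw [hX, Matrix.mul_assoc, ← Matrix.mul_assoc (Matrix.diagonal _) (Matrix.diagonal _),
    Matrix.diagonal_mul_diagonal, ← Matrix.mul_assoc]
  simp only [Real.mul_self_sqrt (hs _).le]

/-- The balanced factors of a compact singular value decomposition attain the bound. -/
theorem IsCompactSVD.isTwoFactorConditionNumber (hk : 1 ≤ k) (hkm : k < m) (hkn : k < n)
    {X : Matrix (Fin m) (Fin n) ℝ} (hX : X.rank = k)
    {U : Matrix (Fin m) (Fin k) ℝ} {s : Fin k → ℝ} {V : Matrix (Fin n) (Fin k) ℝ}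
    (h : IsCompactSVD X U s V) :
    IsTwoFactorConditionNumber (U * Matrix.diagonal (fun i ↦ √(s i)))
        (Matrix.diagonal (fun i ↦ √(s i)) * Vᵀ) (√(sigma k X))⁻¹ := by
  set y₀ : FactorPair m n k := WithLp.toLp 2 (U * Matrix.diagonal (fun i ↦ √(s i)),
    Matrix.diagonal (fun i ↦ √(s i)) * Vᵀ) with hy₀def
  have hy₀ : y₀ ∈ fullRankPairs m n k := h.rank_mul_diagonal_sqrt
  have hyX : factorProduct m n k y₀ = X := h.mul_eq
  obtain ⟨H, hH⟩ := exists_isLocalSolutionMap hy₀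
  have hτ : 0 < √(sigma k X) := Real.sqrt_pos.2 (sigma_pos hk hX)
  have hτs : ∀ i, √(sigma k X) ≤ √(s i) := fun i ↦
    Real.sqrt_le_sqrt (sigma_le_of_isCompactSVD hX h i)
  rw [IsTwoFactorConditionNumber, isInverseLSConditionNumber_factorProduct_iff hy₀ hH]
  refine ⟨⟨by positivity, hH.isEuclideanErrorBound_inv hτ (fun b ↦ ?_) fun a ↦ ?_⟩, ?_⟩
  · rw [hy₀def, WithLp.toLp_fst, Matrix.mul_assoc,
      Matrix.frobenius_norm_mul_of_transpose_mul_self h.1]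
    exact Matrix.mul_norm_le_norm_diagonal_mul hτ.le hτs b
  · rw [hy₀def, WithLp.toLp_snd, ← Matrix.frobenius_norm_transpose (a * _),
      Matrix.transpose_mul, Matrix.transpose_mul, Matrix.transpose_transpose, Matrix.mul_assoc,
      Matrix.frobenius_norm_mul_of_transpose_mul_self h.2.1, Matrix.diagonal_transpose,
      ← Matrix.frobenius_norm_transpose a]
    exact Matrix.mul_norm_le_norm_diagonal_mul hτ.le hτs aᵀ
  · rintro κ ⟨hκ, hb⟩
    have := inv_sqrt_sigma_le_of_isEuclideanErrorBound hk hkm hkn hy₀ (by rw [hyX, hX]) hH hκ hb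
    rwa [hyX] at this

end Main

theorem mainTheorem6 (m n k : ℕ) (hk : 1 ≤ k) (hkm : k < m) (hkn : k < n)
    (X : Matrix (Fin m) (Fin n) ℝ) (hX : X.rank = k) :
    (∀ (L : Matrix (Fin m) (Fin k) ℝ) (R : Matrix (Fin k) (Fin n) ℝ), L.rank = k → R.rank = k →
      L * R = X → ∃! κ : ℝ, IsTwoFactorConditionNumber L R κ) ∧
    IsLeast {κ : ℝ | ∃ (L : Matrix (Fin m) (Fin k) ℝ) (R : Matrix (Fin k) (Fin n) ℝ),
        L.rank = k ∧ R.rank = k ∧ L * R = X ∧ IsTwoFactorConditionNumber L R κ}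
      (sigma k X ^ (-(1 / 2) : ℝ)) ∧
    ∀ (U : Matrix (Fin m) (Fin k) ℝ) (s : Fin k → ℝ) (V : Matrix (Fin n) (Fin k) ℝ),
      IsCompactSVD X U s V →
      (U * Matrix.diagonal (fun i ↦ √(s i))).rank = k ∧
      (Matrix.diagonal (fun i ↦ √(s i)) * Vᵀ).rank = k ∧
      (U * Matrix.diagonal (fun i ↦ √(s i))) * (Matrix.diagonal (fun i ↦ √(s i)) * Vᵀ) = X ∧
      IsTwoFactorConditionNumber (U * Matrix.diagonal (fun i ↦ √(s i)))
        (Matrix.diagonal (fun i ↦ √(s i)) * Vᵀ) (sigma k X ^ (-(1 / 2) : ℝ)) := by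
  have hσ : sigma k X ^ (-(1 / 2) : ℝ) = (√(sigma k X))⁻¹ := by
    rw [Real.rpow_neg (sigma_pos hk hX).le, Real.sqrt_eq_rpow]
  rw [hσ]
  refine ⟨fun L R hL hR _ ↦ ?_, ⟨?_, ?_⟩, fun U s V h ↦ ⟨h.rank_mul_diagonal_sqrt.1,
    h.rank_mul_diagonal_sqrt.2, h.mul_eq, h.isTwoFactorConditionNumber hk hkm hkn hX⟩⟩
  · have hy : (WithLp.toLp 2 (L, R) : FactorPair m n k) ∈ fullRankPairs m n k := ⟨hL, hR⟩
    obtain ⟨H, hH⟩ := exists_isLocalSolutionMap hy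
    simp only [IsTwoFactorConditionNumber, isInverseLSConditionNumber_factorProduct_iff hy hH]
    obtain ⟨κ, hκ⟩ := hH.exists_isLeast
    exact ⟨κ, hκ, fun κ' hκ' ↦ hκ'.unique hκ⟩
  · obtain ⟨U, s, V, h⟩ := exists_isCompactSVD hkn.le hX
    exact ⟨_, _, h.rank_mul_diagonal_sqrt.1, h.rank_mul_diagonal_sqrt.2, h.mul_eq,
      h.isTwoFactorConditionNumber hk hkm hkn hX⟩
  · rintro κ ⟨L, R, hL, hR, hLR, hκ⟩
    have hy : (WithLp.toLp 2 (L, R) : FactorPair m n k) ∈ fullRankPairs m n k := ⟨hL, hR⟩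
    have hyX : factorProduct m n k (WithLp.toLp 2 (L, R)) = X := hLR
    obtain ⟨H, hH⟩ := exists_isLocalSolutionMap hy
    rw [IsTwoFactorConditionNumber, isInverseLSConditionNumber_factorProduct_iff hy hH] at hκ
    rw [← hyX]
    exact inv_sqrt_sigma_le_of_isEuclideanErrorBound hk hkm hkn hy (by rw [hyX, hX]) hH
      hκ.1.1 hκ.1.2
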